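/- **Setting.** Let $d,T\ge 1$, $L>0$, let $\|\cdot\|$ be the Euclidean norm on $\mathbb R^d$, $\mathbb B$ its closed unit ball, $\mathbb S$ its unit sphere. In round $t=1,\dots,T$ the learner plays $w_t\in\mathbb R^d$, a (possibly random and adaptive) environment chooses, on the basis of what happened before round $t$, a convex $L$-Lipschitz loss $\ell_t:\mathbb R^d\to\mathbb R$ with $\ell_t(0)=0$, and the learner observes only the number $\ell_t(w_t)$. The regret against $u\in\mathbb R^d$ is $\mathcal R_T(u)=\sum_{t=1}^T(\ell_t(w_t)-\ell_t(u))$. **Scale learner.** A scale learner $\mathcal A$ on $\mathbb R_+=(0,\infty)$ chooses $v_t>0$ in round $t$ as a function of the previously received loss values $g_1,\dots,g_{t-1}\in\mathbb R$ (and possibly of a random seed drawn beforehand). Given $C\in\mathbb R$ and $k\in\mathbb N$, it implements the scale learning interface with loss bound $L_{\mathcal V}$ if, for every seed, all sequences with $|g_t|\le L_{\mathcal V}$ and all $\hat v>0$, $$\sum_{t=1}^T(v_t-\hat v)g_t\le C\,\bigl(1+\hat v L_{\mathcal V}\sqrt T\bigr)\bigl(1+\ln(1+T)+\ln(1+L_{\mathcal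 V})+\ln(1+\hat v)\bigr)^k .$$ **Algorithm.** Let $\delta=\min\{1,\sqrt d\,T^{-1/4}\}$ and $\eta=\sqrt{\delta^2/(4(dL)^2T)}$, and start with $z_1=0$. In round $t$, get $v_t$ from $\mathcal A$, draw $s_t$ uniformly from $\mathbb S$, independently of everything before (including $\ell_t$ and the seed), play $w_t=v_t(z_t+\delta s_t)$, observe $\ell_t(w_t)$, and put $\hat g_t=\frac{d}{v_t\delta}\ell_t(w_t)s_t$. Send to $\mathcal A$ as its $t$-th loss value $g_t$ a subgradient at $v_t$ of $v\mapsto v\langle z_t,\hat g_t\rangle+2\delta L|v|$, and let $z_{t+1}=\arg\min_{z\in\mathbb B}\ \eta\langle z,\hat g_t\rangle+\|z_t-z\|^2$. (This is the case of domain $\mathcal Z=\mathbb B$ and $\alpha=0$ of the algorithm with update over $(1-\alpha)\mathcal Z$.) **Theorem.** For all $C$ and $k$ there are constants $C'$ and $k'$, depending only on $C$ and $k$, such that for all $d,T\ge1$ and $L>0$, every scale learner on $\mathbb R_+$ that implements the interface over $T$ rounds with loss bound $L_{\mathcal V}=\frac{2dL}{\delta}+2\delta L$ and constants $C,k$, every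 such environment and every $u\in\mathbb R^d$, the regret of the algorithm is integrable and $$\mathbb E[\mathcal R_T(u)]\le C'\bigl(1+\|u\|Ld\sqrt T+\|u\|L\sqrt d\,T^{3/4}\bigr)\bigl(1+\ln(1+T)+\ln(1+L)+\ln(1+d)+\ln(1+\|u\|)\bigr)^{k'},$$ that is, $\mathbb E[\mathcal R_T(u)]=\widetilde O\bigl(1+\|u\|Ld\sqrt T+\|u\|L\sqrt d\,T^{3/4}\bigr)$. -/

import Mathlib

open MeasureTheory ProbabilityTheory
open scoped Pointwise

noncomputable section

namespace ConvexBandit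

/-- The space `ℝ^d` with the Euclidean norm. -/
abbrev Vec (d : ℕ) : Type := EuclideanSpace ℝ (Fin d)

/-- The Euclidean unit sphere of `ℝ^d`. -/
abbrev Sphere (d : ℕ) : Type := Metric.sphere (0 : Vec d) 1

/-- The uniform distribution on the Euclidean unit sphere: normalised surface measure. -/
def uniformSphere (d : ℕ) : Measure (Sphere d) :=
  ((volume : Measure (Vec d)).toSphere Set.univ)⁻¹ • (volume : Measure (Vec d)).toSphere

/-- `g` is a subgradient of `f : ℝ → ℝ` at `x`. -/
def IsSubgradient (f : ℝ → ℝ) (x g : ℝ) : Prop :=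
  ∀ y, f x + g * (y - x) ≤ f y

/-- A one-dimensional online learner with plays in `l`. Its play in a round is a measurable
function of a random seed (an element of `R`, drawn before the first round) and of the loss values
received in the earlier rounds. Rounds are numbered from `0`. A deterministic learner is the case
of a one-point `R`. -/
structure ScaleLearner (l : Set ℝ) (R : Type*) [MeasurableSpace R] where
  play : (t : ℕ) → R → (Fin t → ℝ) → ℝ
  play_mem : ∀ t r h, play t r h ∈ l
  measurable_play : ∀ t, Measurable fun p : R × (Fin t → ℝ) => play t p.1 p.2

/-- The scale learning interface over `T` rounds: on every sequence of loss values bounded by `LV`,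
the regret against every `v' ∈ l` is at most `C * (1 + |v'| * LV * √T)` times the `k`-th power
of a logarithmic factor in `T`, `LV` and `|v'|`. -/
def ScaleLearner.ImplementsInterface {l : Set ℝ} {R : Type*} [MeasurableSpace R]
    (A : ScaleLearner l R) (T : ℕ) (LV C : ℝ) (k : ℕ) : Prop :=
  ∀ (r : R) (g : ℕ → ℝ), (∀ t < T, |g t| ≤ LV) → ∀ v' ∈ l,
    ∑ t ∈ Finset.range T, (A.play t r (fun i : Fin t => g i) - v') * g t ≤
      C * (1 + |v'| * LV * √(T : ℝ)) *
        (1 + Real.log (1 + (T : ℝ)) + Real.log (1 + LV) + Real.log (1 + |v'|)) ^ k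

/-- The surrogate loss `v ↦ v ⟨z, ĝ⟩ + 2 δ L |v|` for general (Lipschitz) convex losses. -/
def surrogateLoss {d : ℕ} (δ L : ℝ) (z ghat : Vec d) (v : ℝ) : ℝ :=
  v * inner ℝ z ghat + 2 * δ * L * |v|

/-- The quantities that the bandit algorithm computes: scalings `v t`, directions `z t`, played
points `w t`, gradient estimates `ghat t` and the loss values `g t` sent to the scale learner. -/
structure Trajectory (d : ℕ) where
  v : ℕ → ℝ
  z : ℕ → Vec d
  w : ℕ → Vec d
  ghat : ℕ → Vec d
  g : ℕ → ℝ

/-- `X` is the trajectory of the black-box comparator-adaptive convex bandit algorithm (for general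
Lipschitz convex losses) over `T` rounds with scale learner `A`, parameters `L`, `δ`, `α`, domain
`Z` and learning rate `η`, when the seed of `A` is `r`, the sampled directions are `s` and the
losses are `ℓ`. A loss enters only through its value at the played point. -/
structure IsRun {d : ℕ} {l : Set ℝ} {R : Type*} [MeasurableSpace R] (A : ScaleLearner l R)
    (T : ℕ) (L δ α : ℝ) (Z : Set (Vec d)) (η : ℝ)
    (r : R) (s : ℕ → Sphere d) (ℓ : ℕ → Vec d → ℝ) (X : Trajectory d) : Prop where
  z_init : X.z 0 = 0
  v_eq : ∀ t < T, X.v t = A.play t r (fun i : Fin t => X.g i)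
  w_eq : ∀ t < T, X.w t = X.v t • (X.z t + δ • (s t : Vec d))
  ghat_eq : ∀ t < T, X.ghat t = ((d : ℝ) / (X.v t * δ) * ℓ t (X.w t)) • (s t : Vec d)
  g_subgradient : ∀ t < T, IsSubgradient (surrogateLoss δ L (X.z t) (X.ghat t)) (X.v t) (X.g t)
  z_mem : ∀ t < T, X.z (t + 1) ∈ (1 - α) • Z
  z_argmin : ∀ t < T,
    IsMinOn (fun z => η * inner ℝ z (X.ghat t) + ‖X.z t - z‖ ^ 2) ((1 - α) • Z) (X.z (t + 1))

/-- The regret `∑ t, (ℓ t (w t) - ℓ t u)` of the points `w` against `u` over `T` rounds. -/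
def regret {d : ℕ} (T : ℕ) (ℓ : ℕ → Vec d → ℝ) (w : ℕ → Vec d) (u : Vec d) : ℝ :=
  ∑ t ∈ Finset.range T, (ℓ t (w t) - ℓ t u)

/-- The losses of a possibly random and adaptive environment: `ℱ t` is the information available
before the direction of round `t` is sampled, and the loss of round `t` is chosen on its basis.
Every loss is convex, `L`-Lipschitz and vanishes at the origin. -/
structure IsEnvironment {d : ℕ} {Ω : Type*} {mΩ : MeasurableSpace Ω} (ℱ : Filtration ℕ mΩ)
    (T : ℕ) (L : ℝ) (ℓ : ℕ → Ω → Vec d → ℝ) : Prop where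
  measurable : ∀ t < T, ∀ x, Measurable[ℱ t] fun ω => ℓ t ω x
  convex : ∀ t < T, ∀ ω, ConvexOn ℝ Set.univ (ℓ t ω)
  lipschitz : ∀ t < T, ∀ ω x y, |ℓ t ω y - ℓ t ω x| ≤ L * ‖y - x‖
  zero : ∀ t < T, ∀ ω, ℓ t ω 0 = 0

/-- In every round `t` the direction `s t` is uniform on the unit sphere and independent of the
information `ℱ t` available before; it is known afterwards. -/
structure IsUniformSampling {d : ℕ} {Ω : Type*} {mΩ : MeasurableSpace Ω} (P : Measure Ω)
    (ℱ : Filtration ℕ mΩ) (s : ℕ → Ω → Sphere d) : Prop where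
  measurable : ∀ t, Measurable[ℱ (t + 1)] (s t)
  law : ∀ t, P.map (s t) = uniformSphere d
  indep : ∀ t, Indep (MeasurableSpace.comap (s t) inferInstance) (ℱ t) P

/-- The smoothing parameter `δ = min {1, √d T^(-1/4)}`. -/
def smoothing (d T : ℕ) : ℝ :=
  min 1 (√(d : ℝ) * (T : ℝ) ^ (-(1 / 4) : ℝ))

/-- The learning rate `η = √(δ² / (4 (d L)² T))`. -/
def learningRate (d T : ℕ) (L δ : ℝ) : ℝ :=
  √(δ ^ 2 / (4 * ((d : ℝ) * L) ^ 2 * (T : ℝ)))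

/-- The bound `2 d L / δ + 2 δ L` on the loss values sent to the scale learner. -/
def scaleLossBound (d : ℕ) (L δ : ℝ) : ℝ :=
  2 * (d : ℝ) * L / δ + 2 * δ * L

end ConvexBandit

end

/-!
The learner sees only one loss value per round, so the proof rests on the fact that the one-point
estimate `ĝ = (d / r) ℓ(x + r s) s`, with `s` uniform on the sphere, acts in expectation as a
subgradient of `ℓ` at `x`: for convex `L`-Lipschitz `ℓ`,
`E ⟨ĝ, u - x⟩ ≤ ℓ(u) - ℓ(x) + L r` (`integral_sphere_mul_inner_le`). No divergence theorem is needed.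
Averaging over `s`, `-s` and their mirror images in the hyperplane orthogonal to `u - x` reduces the
claim to an inequality about the mean slope of a convex function of one variable
(`convexOn_slope_mul_le`), weighted by the squared component of `s` along `u - x`, which has mean
`1 / d` (`integral_inner_sq_sphere`).

With `x = v z` and `r = v δ`, and with another error `L v δ` for playing `v (z + δ s)` instead of
`v z`, the expected loss of a round exceeds that of `u` by at most the expectation of
`v ⟨z, ĝ⟩ + 2 δ L v - ⟨ĝ, u⟩` (`integrable_and_integral_loss_le`). The errors add up to exactly the
term `2 δ L v` of the surrogate loss, so that they are charged to the scale learner. Conditioning on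
the past is replaced by Fubini's theorem for the independent pair of past and direction
(`integral_le_of_indepFun`). Everything is integrable because the interface itself forces the
scalings to be bounded (`ScaleLearner.ImplementsInterface.exists_play_le`).

Pathwise, the sum of these terms is the regret of the scale learner against a scaling `V`, plus `V`
times the regret of projected gradient descent against `u / V`, plus `2 δ L V T`
(`IsRun.sum_linearised_le`). This holds for every positive `V ≥ ‖u‖`; letting `V` decrease to `‖u‖`
covers `u = 0` too. The choice of `δ` balances `d √T / δ` against `δ T` (`smoothing_balance`).
-/

namespace ConvexBandit

/-! ### Convex functions on the line -/

/-- The mean slope of a convex function on `[-a, a]`, multiplied by `H`, is at most the difference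
between the maximum over `[H - a, H + a]` and the value at `0`. -/
theorem convexOn_slope_mul_le {ψ : ℝ → ℝ} (hψ : ConvexOn ℝ Set.univ ψ) {a H U : ℝ} (hH : 0 ≤ H)
    (hU : ∀ y, |y| ≤ |a| → ψ (H + y) ≤ U) :
    a * (ψ a - ψ (-a)) * H ≤ 2 * a ^ 2 * (U - ψ 0) := by
  -- both sides are even in `a`
  wlog ha : 0 ≤ a generalizing a
  · have := this (a := -a) (by simpa using hU) (by linarith)
    simp only [neg_neg, neg_sq] at this
    linarith
  rcases ha.eq_or_lt with rfl | ha
  · simp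
  rw [abs_of_pos ha] at hU
  suffices h : (ψ a - ψ (-a)) * H ≤ 2 * a * (U - ψ 0) by nlinarith
  -- convexity in cross-multiplied form
  have cvx : ∀ x y z, x < y → y < z → ψ y * (z - x) ≤ ψ x * (z - y) + ψ z * (y - x) := by
    intro x y z hxy hyz
    have := hψ.slope_mono_adjacent (Set.mem_univ x) (Set.mem_univ z) hxy hyz
    rw [div_le_div_iff₀ (by linarith) (by linarith)] at this
    linarith
  have h0 := cvx (-a) 0 a (by linarith) ha
  have hm0 : 2 * ψ 0 ≤ ψ a + ψ (-a) := by nlinarith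
  rcases hH.eq_or_lt with rfl | hH
  · have := hU 0 (by simpa using ha.le)
    simp only [zero_add, mul_zero] at this ⊢
    nlinarith
  by_cases hc : ψ 0 ≤ ψ a
  · -- the chord of `[-a, a]` is less steep than the chord of `[a, a + H]`
    have h1 := cvx (-a) a (H + a) (by linarith) (by linarith)
    have h2 := hU a (by rw [abs_of_pos ha])
    nlinarith
  push Not at hc
  -- now `ψ` decreases, and the point of `[H - a, H + a]` closest to `0` is the one to compare with
  rcases le_or_gt H a with hHa | hHa
  · have h2 := hU (-H) (by rw [abs_neg, abs_of_pos hH]; exact hHa)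
    simp only [add_neg_cancel] at h2
    nlinarith
  have h2 := hU (-a) (by rw [abs_neg, abs_of_pos ha])
  rcases le_or_gt H (2 * a) with hHa2 | hHa2
  · have h1 := cvx (-a) 0 (H + -a) (by linarith) (by linarith)
    have h3 : 0 ≤ (2 * a - H) * (ψ a + ψ (-a) - 2 * ψ 0) :=
      mul_nonneg (by linarith) (by linarith)
    have h4 : 0 ≤ a * (ψ 0 - ψ a) := mul_nonneg ha.le (by linarith)
    nlinarith
  · have h1 := cvx (-a) a (H + -a) (by linarith) (by linarith)
    nlinarith

/-! ### The uniform distribution on the sphere -/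

section Sphere

variable {d : ℕ}

theorem isProbabilityMeasure_uniformSphere (hd : 0 < d) :
    IsProbabilityMeasure (uniformSphere d) := by
  have : Nonempty (Fin d) := ⟨⟨0, hd⟩⟩
  have h0 : (volume : Measure (Vec d)).toSphere Set.univ ≠ 0 := by
    rw [Ne, Measure.measure_univ_eq_zero]
    exact Measure.toSphere_ne_zero _
  exact ⟨by
    rw [uniformSphere, Measure.smul_apply, smul_eq_mul,
      ENNReal.inv_mul_cancel h0 (measure_ne_top _ _)]⟩

/-- The action of a linear isometry on the unit sphere. -/
noncomputable def sphereMap (A : Vec d ≃ₗᵢ[ℝ] Vec d) (s : Sphere d) : Sphere d :=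
  ⟨A s, by simp⟩

theorem continuous_sphereMap (A : Vec d ≃ₗᵢ[ℝ] Vec d) : Continuous (sphereMap A) :=
  (A.continuous.comp continuous_subtype_val).subtype_mk _

/-- Surface measure is defined through the volume of cones, and a linear isometry maps the cone
over a set to the cone over its image. -/
theorem map_sphereMap_uniformSphere (A : Vec d ≃ₗᵢ[ℝ] Vec d) :
    (uniformSphere d).map (sphereMap A) = uniformSphere d := by
  have hm : Measurable (sphereMap A) := (continuous_sphereMap A).measurable
  rw [uniformSphere, Measure.map_smul]
  congr 1
  ext S hS
  rw [Measure.map_apply hm hS, Measure.toSphere_apply' _ (hm hS), Measure.toSphere_apply' _ hS]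
  congr 1
  have : Set.Ioo (0 : ℝ) 1 • (Subtype.val '' (sphereMap A ⁻¹' S) : Set (Vec d)) =
      A ⁻¹' (Set.Ioo (0 : ℝ) 1 • (Subtype.val '' S)) := by
    ext x
    simp only [Set.mem_smul, Set.mem_image, Set.mem_preimage]
    constructor
    · rintro ⟨c, hc, _, ⟨s, hs, rfl⟩, rfl⟩
      exact ⟨c, hc, _, ⟨_, hs, rfl⟩, by simp [sphereMap]⟩
    · rintro ⟨c, hc, _, ⟨s, hs, rfl⟩, hx⟩
      refine ⟨c, hc, _, ⟨sphereMap A.symm s, ?_, rfl⟩, ?_⟩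
      · have : sphereMap A (sphereMap A.symm s) = s := Subtype.ext (by simp [sphereMap])
        simpa [this] using hs
      · apply A.injective
        simp [sphereMap, ← hx]
  rw [this]
  exact A.measurePreserving.measure_preimage_equiv (f := A.toMeasurableEquiv) _

theorem integral_sphere_comp_isometry (A : Vec d ≃ₗᵢ[ℝ] Vec d) {φ : Vec d → ℝ}
    (hφ : Continuous φ) :
    ∫ s, φ (A s) ∂uniformSphere d = ∫ s, φ (s : Vec d) ∂uniformSphere d := by
  conv_rhs => rw [← map_sphereMap_uniformSphere A]
  exact (integral_map (continuous_sphereMap A).aemeasurable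
    (hφ.comp continuous_subtype_val).aestronglyMeasurable).symm

theorem integrable_sphere (hd : 0 < d) {φ : Vec d → ℝ} (hφ : Continuous φ) :
    Integrable (fun s : Sphere d => φ s) (uniformSphere d) := by
  have := isProbabilityMeasure_uniformSphere hd
  obtain ⟨M, hM⟩ := (isCompact_univ (X := Sphere d)).exists_bound_of_continuousOn
    (hφ.comp continuous_subtype_val).continuousOn
  exact Integrable.of_bound (hφ.comp continuous_subtype_val).aestronglyMeasurable M
    (ae_of_all _ fun s => hM s (Set.mem_univ s))

/-- All coordinates of a uniform direction have the same second moment, and these add up to `1`. -/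
theorem integral_inner_sq_sphere (hd : 0 < d) (e : Vec d) :
    ∫ s : Sphere d, (inner ℝ (s : Vec d) e) ^ 2 ∂uniformSphere d = ‖e‖ ^ 2 / d := by
  have := isProbabilityMeasure_uniformSphere hd
  -- a reflection exchanges any two vectors of the same length
  have same : ∀ v w : Vec d, ‖v‖ = ‖w‖ →
      ∫ s : Sphere d, (inner ℝ (s : Vec d) v) ^ 2 ∂uniformSphere d =
        ∫ s : Sphere d, (inner ℝ (s : Vec d) w) ^ 2 ∂uniformSphere d := by
    intro v w h
    set A := (Submodule.span ℝ {v - w})ᗮ.reflection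
    have hA : A v = w := Submodule.reflection_sub h
    rw [← integral_sphere_comp_isometry A (φ := fun x => (inner ℝ x w) ^ 2) (by fun_prop)]
    congr with s
    rw [← hA, A.inner_map_map]
  have key : ∀ i : Fin d,
      ∫ s : Sphere d, (inner ℝ (s : Vec d) (‖e‖ • EuclideanSpace.single i (1 : ℝ))) ^ 2
        ∂uniformSphere d =
      ∫ s : Sphere d, (inner ℝ (s : Vec d) e) ^ 2 ∂uniformSphere d :=
    fun i => same _ _ (by simp [norm_smul])
  have hsum := Finset.sum_congr (rfl : (Finset.univ : Finset (Fin d)) = _) fun i _ => key i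
  rw [← integral_finsetSum _ fun i _ => integrable_sphere hd
    (φ := fun x => (inner ℝ x (‖e‖ • EuclideanSpace.single i (1 : ℝ))) ^ 2) (by fun_prop)] at hsum
  have h1 : ∀ s : Sphere d, ∑ i : Fin d,
      (inner ℝ (s : Vec d) (‖e‖ • EuclideanSpace.single i (1 : ℝ))) ^ 2 = ‖e‖ ^ 2 := by
    intro s
    have hs : ‖(s : Vec d)‖ ^ 2 = 1 := by simp
    rw [EuclideanSpace.real_norm_sq_eq] at hs
    simp only [inner_smul_right, EuclideanSpace.inner_single_right, mul_pow]
    rw [← Finset.mul_sum]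
    simp [hs]
  simp only [h1, integral_const, probReal_univ, one_smul, Finset.sum_const, Finset.card_univ,
    Fintype.card_fin, nsmul_eq_mul] at hsum
  rw [hsum]
  field_simp

/-- The sum of `σ ↦ f (x + r σ) ⟨σ, H e⟩` over the point `s = p + q e` of the sphere, its mirror
image `p - q e` in the hyperplane orthogonal to `e`, and their antipodes. It equals
`2 q H (ψ (r q) - ψ (-(r q)))`, where `ψ y` is the mean of `f` at `x + r p + y e` and `x - r p + y e`.
This `ψ` is convex, `f x ≤ ψ 0` by convexity, and `ψ` is at most `f (x + H e) + L r` on the interval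
of radius `r |q|` around `H`, because the points involved are within `r` of `x + H e`. -/
theorem sum_reflections_le {f : Vec d → ℝ} {L r H : ℝ}
    (hf : ConvexOn ℝ Set.univ f) (hL : ∀ x y, |f y - f x| ≤ L * ‖y - x‖) (hL0 : 0 ≤ L)
    (hr : 0 < r) (hH : 0 ≤ H) (x : Vec d) {e p : Vec d} {q : ℝ} (hne : ‖e‖ = 1)
    (hpe : inner ℝ p e = (0 : ℝ)) (hpq : ‖p‖ ^ 2 + q ^ 2 = 1) :
    q * H * (f (x + r • (p + q • e)) - f (x + r • (p - q • e))
      - f (x + r • -(p + q • e)) + f (x + r • -(p - q • e))) ≤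
      4 * r * (f (x + H • e) + L * r - f x) * q ^ 2 := by
  set U := f (x + H • e) + L * r with hU
  let ψ : ℝ → ℝ := fun y => (f (x + r • p + y • e) + f (x - r • p + y • e)) / 2
  have hline : ∀ b : Vec d, ConvexOn ℝ Set.univ fun y : ℝ => f (b + y • e) := by
    intro b
    have := hf.comp_affineMap (AffineMap.lineMap b (b + e) : ℝ →ᵃ[ℝ] Vec d)
    simpa [Function.comp_def, AffineMap.lineMap_apply, add_comm] using this
  have hψ : ConvexOn ℝ Set.univ ψ := by
    have := ((hline (x + r • p)).add (hline (x - r • p))).smul (c := (1 / 2 : ℝ)) (by norm_num)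
    refine this.congr fun y _ => ?_
    simp only [Pi.add_apply, smul_eq_mul, ψ]
    ring
  have hψ0 : f x ≤ ψ 0 := by
    have := hf.2 (Set.mem_univ (x + r • p)) (Set.mem_univ (x - r • p))
      (by norm_num : (0 : ℝ) ≤ 1 / 2) (by norm_num : (0 : ℝ) ≤ 1 / 2) (by norm_num)
    have hx : (1 / 2 : ℝ) • (x + r • p) + (1 / 2 : ℝ) • (x - r • p) = x := by module
    rw [hx] at this
    simp only [ψ, zero_smul, add_zero, smul_eq_mul] at this ⊢
    linarith
  have hψU : ∀ y, |y| ≤ |r * q| → ψ (H + y) ≤ U := by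
    intro y hy
    have hb : ∀ σ : ℝ, σ ^ 2 = 1 → f (x + H • e + (σ * r) • p + y • e) ≤ U := by
      intro σ hσ
      have h1 := (le_abs_self _).trans (hL (x + H • e) (x + H • e + (σ * r) • p + y • e))
      have h2 : ‖x + H • e + (σ * r) • p + y • e - (x + H • e)‖ ≤ r := by
        have : x + H • e + (σ * r) • p + y • e - (x + H • e) = (σ * r) • p + y • e := by abel
        rw [this]
        refine le_of_sq_le_sq ?_ hr.le
        rw [norm_add_sq_real, inner_smul_left, inner_smul_right, hpe, norm_smul, norm_smul, hne,
          mul_pow, Real.norm_eq_abs, Real.norm_eq_abs, sq_abs, mul_pow, hσ]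
        have := sq_le_sq.2 hy
        simp only [mul_zero, add_zero, mul_one, one_mul, sq_abs]
        nlinarith
      have := mul_le_mul_of_nonneg_left h2 hL0
      linarith
    have h1 := hb 1 (by norm_num)
    have h2 := hb (-1) (by norm_num)
    have e1 : x + r • p + (H + y) • e = x + H • e + (1 * r) • p + y • e := by module
    have e2 : x - r • p + (H + y) • e = x + H • e + (-1 * r) • p + y • e := by module
    simp only [ψ, e1, e2]
    linarith
  have h1d := convexOn_slope_mul_le hψ hH hψU
  have x1 : x + r • (p + q • e) = x + r • p + (r * q) • e := by module
  have x2 : x + r • (p - q • e) = x + r • p + (-(r * q)) • e := by module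
  have x3 : x + r • -(p + q • e) = x - r • p + (-(r * q)) • e := by module
  have x4 : x + r • -(p - q • e) = x - r • p + (r * q) • e := by module
  have hψ2 : f (x + r • (p + q • e)) - f (x + r • (p - q • e))
      - f (x + r • -(p + q • e)) + f (x + r • -(p - q • e)) =
      2 * (ψ (r * q) - ψ (-(r * q))) := by
    simp only [ψ, x1, x2, x3, x4]
    ring
  rw [hψ2]
  refine le_of_mul_le_mul_left ?_ hr
  have : 2 * (r * q) ^ 2 * (U - ψ 0) ≤ 2 * (r * q) ^ 2 * (U - f x) :=
    mul_le_mul_of_nonneg_left (by linarith) (by positivity)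
  linear_combination 2 * h1d + 2 * this

theorem continuous_of_abs_sub_le {f : Vec d → ℝ} {L : ℝ} (hL0 : 0 ≤ L)
    (hL : ∀ x y, |f y - f x| ≤ L * ‖y - x‖) : Continuous f := by
  refine (LipschitzWith.of_dist_le_mul (K := ⟨L, hL0⟩) fun y x => ?_).continuous
  rw [Real.dist_eq, dist_eq_norm]
  exact hL x y

/-- The one-point gradient estimate linearises a convex function: its mean acts as a subgradient
at `x`, up to an error `L * r`. The bound is a symmetrisation over four points of the sphere. -/
theorem integral_sphere_mul_inner_le (hd : 0 < d) {f : Vec d → ℝ} {L r : ℝ}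
    (hf : ConvexOn ℝ Set.univ f) (hL : ∀ x y, |f y - f x| ≤ L * ‖y - x‖) (hL0 : 0 ≤ L)
    (hr : 0 < r) (x h : Vec d) :
    (d : ℝ) / r * ∫ s : Sphere d, f (x + r • (s : Vec d)) * inner ℝ (s : Vec d) h
      ∂uniformSphere d ≤ f (x + h) + L * r - f x := by
  have := isProbabilityMeasure_uniformSphere hd
  rcases eq_or_ne h 0 with rfl | hh
  · simp only [inner_zero_right, mul_zero, integral_zero, add_zero]
    nlinarith
  have hcont : Continuous f := continuous_of_abs_sub_le hL0 hL
  obtain ⟨H, e, hH, hne, rfl⟩ : ∃ (H : ℝ) (e : Vec d), 0 < H ∧ ‖e‖ = 1 ∧ h = H • e :=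
    ⟨‖h‖, ‖h‖⁻¹ • h, norm_pos_iff.2 hh, by
      rw [norm_smul, norm_inv, norm_norm, inv_mul_cancel₀ (norm_ne_zero_iff.2 hh)], by
      rw [smul_smul, mul_inv_cancel₀ (norm_ne_zero_iff.2 hh), one_smul]⟩
  have hee : inner ℝ e e = (1 : ℝ) := by rw [real_inner_self_eq_norm_sq, hne]; norm_num
  obtain ⟨A, hAx⟩ : ∃ A : Vec d ≃ₗᵢ[ℝ] Vec d, ∀ s, A s = s - (2 * inner ℝ s e) • e := by
    refine ⟨(Submodule.span ℝ {e})ᗮ.reflection, fun s => ?_⟩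
    rw [Submodule.reflection_orthogonal_apply, Submodule.reflection_singleton_apply, hne,
      real_inner_comm]
    simp only [RCLike.ofReal_real_eq_id, id_eq]
    module
  obtain ⟨F, hFdef⟩ : ∃ F : Vec d → ℝ, F = fun s => f (x + r • s) * inner ℝ s (H • e) := ⟨_, rfl⟩
  have hF : Continuous F := by rw [hFdef]; fun_prop
  have hFA : Continuous fun s => F (A s) := hF.comp A.continuous
  have hFn : Continuous fun s => F (-s) := hF.comp continuous_neg
  have hFAn : Continuous fun s => F (-(A s)) := hFn.comp A.continuous
  have e1 := integral_sphere_comp_isometry A hF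
  have e2 := integral_sphere_comp_isometry (LinearIsometryEquiv.neg ℝ) hF
  have e3 := integral_sphere_comp_isometry A hFn
  simp only [LinearIsometryEquiv.coe_neg] at e2
  have hsum : 4 * ∫ s : Sphere d, F s ∂uniformSphere d =
      ∫ s : Sphere d, (F s + F (A s) + F (-s) + F (-(A s))) ∂uniformSphere d := by
    have c2 : Continuous fun s => F s + F (A s) := hF.add hFA
    have c3 : Continuous fun s => F s + F (A s) + F (-s) := c2.add hFn
    rw [integral_add (integrable_sphere hd c3) (integrable_sphere hd hFAn),
      integral_add (integrable_sphere hd c2) (integrable_sphere hd hFn),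
      integral_add (integrable_sphere hd hF) (integrable_sphere hd hFA), e1, e3, e2]
    ring
  set U := f (x + H • e) + L * r with hU
  have hpt : ∀ s : Sphere d, F s + F (A s) + F (-s) + F (-(A s)) ≤
      4 * r * (U - f x) * (inner ℝ (s : Vec d) e) ^ 2 := by
    intro s
    obtain ⟨q, hq⟩ : ∃ q : ℝ, q = inner ℝ (s : Vec d) e := ⟨_, rfl⟩
    obtain ⟨p, hp⟩ : ∃ p : Vec d, p = s - q • e := ⟨_, rfl⟩
    have hsp : (s : Vec d) = p + q • e := by rw [hp]; abel
    have hpe : inner ℝ p e = (0 : ℝ) := by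
      rw [hp, inner_sub_left, inner_smul_left, hee]; simp [hq]
    have hpq : ‖p‖ ^ 2 + q ^ 2 = 1 := by
      have h1 : ‖(s : Vec d)‖ ^ 2 = 1 := by simp
      rw [hsp, norm_add_sq_real, inner_smul_right, hpe, norm_smul, hne] at h1
      simpa using h1
    have hAs : A s = p - q • e := by rw [hAx, hp, ← hq]; module
    have key := sum_reflections_le hf hL hL0 hr hH.le x hne hpe hpq
    have i1 : inner ℝ (p + q • e) (H • e) = q * H := by
      rw [inner_smul_right, inner_add_left, hpe, inner_smul_left, hee]
      simp; ring
    have i2 : inner ℝ (p - q • e) (H • e) = -(q * H) := by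
      rw [inner_smul_right, inner_sub_left, hpe, inner_smul_left, hee]
      simp; ring
    rw [← hq, hAs, hsp]
    simp only [hFdef, inner_neg_left, i1, i2]
    linear_combination key
  have hint := integral_mono
    (integrable_sphere hd (((hF.add hFA).add hFn).add hFAn))
    (integrable_sphere hd (φ := fun s => 4 * r * (U - f x) * (inner ℝ s e) ^ 2) (by fun_prop)) hpt
  rw [integral_const_mul, integral_inner_sq_sphere hd, hne] at hint
  have hint' := hsum.trans_le hint
  have hd' : (0 : ℝ) < d := Nat.cast_pos.2 hd
  rw [hFdef] at hint'
  rw [div_mul_eq_mul_div, div_le_iff₀ hr]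
  have : 4 * r * (U - f x) * (1 ^ 2 / d) * d = 4 * r * (U - f x) := by field_simp
  linear_combination mul_le_mul_of_nonneg_right hint' hd'.le / 4 + this / 4

/-! ### Projected gradient steps in the unit ball -/

/-- First-order optimality of the proximal gradient step. -/
theorem inner_le_zero_of_isMinOn {η : ℝ} {z g z' : Vec d} {K : Set (Vec d)} (hK : Convex ℝ K)
    (hz' : z' ∈ K) (hmin : IsMinOn (fun y => η * inner ℝ y g + ‖z - y‖ ^ 2) K z')
    {c : Vec d} (hc : c ∈ K) :
    inner ℝ (z - (η / 2) • g - z') (c - z') ≤ (0 : ℝ) := by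
  have key : ∀ l : ℝ, 0 < l → l ≤ 1 →
      2 * inner ℝ (z - (η / 2) • g - z') (c - z') ≤ l * ‖c - z'‖ ^ 2 := by
    intro l hl hl1
    have hm : z' + l • (c - z') ∈ K := hK.add_smul_sub_mem hz' hc ⟨hl.le, hl1⟩
    have h1 : η * inner ℝ z' g + ‖z - z'‖ ^ 2 ≤
      η * inner ℝ (z' + l • (c - z')) g + ‖z - (z' + l • (c - z'))‖ ^ 2 := hmin hm
    have h2 : z - (z' + l • (c - z')) = (z - z') - l • (c - z') := by abel
    rw [h2, norm_sub_sq_real (z - z'), inner_add_left, inner_smul_left, inner_smul_right, norm_smul,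
      mul_pow, Real.norm_eq_abs, sq_abs] at h1
    have h3 : inner ℝ (z - (η / 2) • g - z') (c - z') =
        inner ℝ (z - z') (c - z') - η / 2 * inner ℝ (c - z') g := by
      rw [sub_right_comm, inner_sub_left, inner_smul_left, real_inner_comm (c - z') g]
      simp
    rw [h3]
    refine le_of_mul_le_mul_left ?_ hl
    simp only [conj_trivial] at h1
    nlinarith
  by_contra! hpos
  set I : ℝ := inner ℝ (z - (η / 2) • g - z') (c - z')
  set B : ℝ := ‖c - z'‖ ^ 2
  have hB : 0 ≤ B := sq_nonneg _
  have h1 := key (min 1 (I / (B + 1))) (lt_min one_pos (by positivity)) (min_le_left _ _)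
  have h2 : min 1 (I / (B + 1)) * B ≤ I / (B + 1) * B :=
    mul_le_mul_of_nonneg_right (min_le_right _ _) hB
  have h3 : I / (B + 1) * B ≤ I := by
    rw [div_mul_eq_mul_div, div_le_iff₀ (by positivity)]
    nlinarith
  linarith

/-- The metric projection onto the closed unit ball. -/
noncomputable def ballProj (y : Vec d) : Vec d := (max 1 ‖y‖)⁻¹ • y

theorem continuous_ballProj : Continuous (ballProj : Vec d → Vec d) := by
  unfold ballProj
  exact ((continuous_const.max continuous_norm).inv₀ fun y =>
    (lt_of_lt_of_le one_pos (le_max_left _ _)).ne').smul continuous_id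

theorem eq_ballProj_of_isMinOn {η : ℝ} {z g z' : Vec d}
    (hz' : z' ∈ Metric.closedBall (0 : Vec d) 1)
    (hmin : IsMinOn (fun y => η * inner ℝ y g + ‖z - y‖ ^ 2) (Metric.closedBall 0 1) z') :
    z' = ballProj (z - (η / 2) • g) := by
  set y := z - (η / 2) • g with hy
  have hz1 : ‖z'‖ ≤ 1 := by simpa using hz'
  have hp : ‖ballProj y‖ ≤ 1 := by
    rw [ballProj, norm_smul, norm_inv, Real.norm_of_nonneg (by positivity)]
    exact inv_mul_le_one_of_le₀ (le_max_right _ _) (by positivity)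
  have h1 : inner ℝ (y - z') (ballProj y - z') ≤ (0 : ℝ) :=
    inner_le_zero_of_isMinOn (convex_closedBall _ _) hz' hmin (by simpa using hp)
  have h2 : inner ℝ (y - ballProj y) (z' - ballProj y) ≤ (0 : ℝ) := by
    rcases le_or_gt ‖y‖ 1 with h | h
    · simp [ballProj, max_eq_left h]
    · have hy0 : 0 < ‖y‖ := by linarith
      have hp1 : ballProj y = ‖y‖⁻¹ • y := by rw [ballProj, max_eq_right h.le]
      have hpn : ‖ballProj y‖ = 1 := by
        rw [hp1, norm_smul, norm_inv, norm_norm, inv_mul_cancel₀ hy0.ne']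
      have hyp : y = ‖y‖ • ballProj y := by
        rw [hp1, smul_smul, mul_inv_cancel₀ hy0.ne', one_smul]
      have : y - ballProj y = (‖y‖ - 1) • ballProj y := by
        nth_rewrite 1 [hyp]; module
      rw [this, inner_smul_left, inner_sub_right, real_inner_self_eq_norm_sq, hpn]
      have hi : inner ℝ (ballProj y) z' ≤ 1 * 1 :=
        (real_inner_le_norm _ _).trans (mul_le_mul hp hz1 (norm_nonneg _) zero_le_one)
      simp only [conj_trivial]
      nlinarith
  have h3 : inner ℝ (z' - ballProj y) (z' - ballProj y) ≤ (0 : ℝ) := by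
    have : inner ℝ (z' - ballProj y) (z' - ballProj y) =
        inner ℝ (y - z') (ballProj y - z') + inner ℝ (y - ballProj y) (z' - ballProj y) := by
      rw [← neg_sub z' (ballProj y), inner_neg_right, ← sub_eq_neg_add, ← inner_sub_left]
      congr 1
      abel
    linarith
  exact sub_eq_zero.1 (real_inner_self_nonpos.1 h3)

theorem norm_sub_sq_le_of_isMinOn {η : ℝ} {z g z' : Vec d} {K : Set (Vec d)} (hK : Convex ℝ K)
    (hz' : z' ∈ K) (hmin : IsMinOn (fun y => η * inner ℝ y g + ‖z - y‖ ^ 2) K z')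
    {c : Vec d} (hc : c ∈ K) :
    ‖z' - c‖ ^ 2 ≤ ‖z - c‖ ^ 2 - η * inner ℝ g (z - c) + η ^ 2 / 4 * ‖g‖ ^ 2 := by
  have h := inner_le_zero_of_isMinOn hK hz' hmin hc
  set y := z - (η / 2) • g with hy
  have h1 : ‖y - c‖ ^ 2 = ‖z - c‖ ^ 2 - η * inner ℝ g (z - c) + η ^ 2 / 4 * ‖g‖ ^ 2 := by
    have : y - c = (z - c) - (η / 2) • g := by rw [hy]; abel
    rw [this, norm_sub_sq_real, inner_smul_right, norm_smul, mul_pow, Real.norm_eq_abs, sq_abs,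
      real_inner_comm]
    ring
  have h2 : ‖y - c‖ ^ 2 = ‖y - z'‖ ^ 2 - 2 * inner ℝ (y - z') (c - z') + ‖z' - c‖ ^ 2 := by
    have : y - c = (y - z') - (c - z') := by abel
    rw [this, norm_sub_sq_real, norm_sub_rev c z']
  nlinarith [sq_nonneg ‖y - z'‖]

/-- The regret of projected gradient descent in a set of radius `1` around the starting point. -/
theorem sum_inner_le_of_isMinOn {η G : ℝ} (hη : 0 < η) {T : ℕ} {z g : ℕ → Vec d}
    {K : Set (Vec d)} (hK : Convex ℝ K) {c : Vec d} (hc : c ∈ K) (hz0 : ‖z 0 - c‖ ≤ 1)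
    (hz : ∀ t < T, z (t + 1) ∈ K)
    (hmin : ∀ t < T,
      IsMinOn (fun y => η * inner ℝ y (g t) + ‖z t - y‖ ^ 2) K (z (t + 1)))
    (hg : ∀ t < T, ‖g t‖ ≤ G) :
    ∑ t ∈ Finset.range T, inner ℝ (g t) (z t - c) ≤ 1 / η + η / 4 * (T * G ^ 2) := by
  -- telescoping, with the squared distance to `c` as potential
  have key : ∀ n ≤ T, η * ∑ t ∈ Finset.range n, inner ℝ (g t) (z t - c) + ‖z n - c‖ ^ 2 ≤
      1 + η ^ 2 / 4 * (n * G ^ 2) := by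
    intro n
    induction n with
    | zero =>
      intro _
      have := pow_le_one₀ (n := 2) (norm_nonneg _) hz0
      simpa using this
    | succ n ih =>
      intro hn
      have h1 := ih (by omega)
      have h2 := norm_sub_sq_le_of_isMinOn hK (hz n hn) (hmin n hn) hc
      have h3 : ‖g n‖ ^ 2 ≤ G ^ 2 := pow_le_pow_left₀ (norm_nonneg _) (hg n hn) 2
      have h4 : η ^ 2 / 4 * ‖g n‖ ^ 2 ≤ η ^ 2 / 4 * G ^ 2 :=
        mul_le_mul_of_nonneg_left h3 (by positivity)
      rw [Finset.sum_range_succ]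
      push_cast
      nlinarith
  have h := key T le_rfl
  refine le_of_mul_le_mul_left ?_ hη
  have : η * (1 / η + η / 4 * (T * G ^ 2)) = 1 + η ^ 2 / 4 * (T * G ^ 2) := by
    field_simp
  rw [this]
  nlinarith [sq_nonneg ‖z T - c‖]

end Sphere

/-! ### Scale learners play bounded scalings -/

/-- On bounded loss values, a learner with a regret guarantee plays bounded scalings: a large play
`v` could be punished by the loss value `LV`, followed by zeros. -/
theorem ScaleLearner.ImplementsInterface.exists_play_le {R : Type*} [MeasurableSpace R]
    {A : ScaleLearner (Set.Ioi (0 : ℝ)) R} {T : ℕ} {LV C : ℝ} {k : ℕ}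
    (hA : A.ImplementsInterface T LV C k) (hLV : 0 < LV) :
    ∃ V : ℝ, ∀ t < T, ∀ (r : R) (h : Fin t → ℝ), (∀ i, |h i| ≤ LV) → A.play t r h ≤ V := by
  set B : ℝ := C * (1 + |(1 : ℝ)| * LV * √(T : ℝ)) *
    (1 + Real.log (1 + (T : ℝ)) + Real.log (1 + LV) + Real.log (1 + |(1 : ℝ)|)) ^ k
  suffices H : ∀ n ≤ T, ∃ V : ℝ, 0 ≤ V ∧
      ∀ t < n, ∀ (r : R) (h : Fin t → ℝ), (∀ i, |h i| ≤ LV) → A.play t r h ≤ V by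
    obtain ⟨V, -, hV⟩ := H T le_rfl
    exact ⟨V, hV⟩
  intro n
  induction n with
  | zero => exact fun _ => ⟨0, le_rfl, fun t ht => absurd ht (Nat.not_lt_zero t)⟩
  | succ n ih =>
    intro hn
    obtain ⟨V, hV0, hV⟩ := ih (by omega)
    refine ⟨max V ((B + T * ((V + 1) * LV)) / LV), le_max_of_le_left hV0, fun t ht r h hh => ?_⟩
    rcases Nat.lt_succ_iff_lt_or_eq.1 ht with ht | rfl
    · exact (hV t ht r h hh).trans (le_max_left _ _)
    refine le_max_of_le_right ?_
    -- the history `h`, then the value `LV` once, then zeros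
    let g : ℕ → ℝ := fun i => if hi : i < t then h ⟨i, hi⟩ else if i = t then LV else 0
    have hg : ∀ i, |g i| ≤ LV := by
      intro i
      by_cases hi : i < t
      · simpa [g, hi] using hh _
      · by_cases hit : i = t
        · simp [g, hit, abs_of_pos hLV]
        · simp [g, hi, hit, hLV.le]
    have hgt : g t = LV := by simp [g]
    have hgh : (fun i : Fin t => g i) = h := by
      funext i
      simp [g]
    have hbound := hA r g (fun i _ => hg i) 1 (Set.mem_Ioi.2 one_pos)
    have hterm : ∀ i ∈ Finset.range T, -((V + 1) * LV) + (if i = t then A.play t r h * LV else 0) ≤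
        (A.play i r (fun j : Fin i => g j) - 1) * g i := by
      intro i _
      have hVLV : 0 ≤ V * LV := mul_nonneg hV0 hLV.le
      rcases lt_trichotomy i t with hi | rfl | hi
      · have h1 := hV i hi r (fun j : Fin i => g j) fun j => hg j
        have h2 : 0 < A.play i r (fun j : Fin i => g j) := A.play_mem i r _
        have h3 : |A.play i r (fun j : Fin i => g j) - 1| ≤ V + 1 := by
          rw [abs_le]; constructor <;> linarith
        have h4 : |(A.play i r (fun j : Fin i => g j) - 1) * g i| ≤ (V + 1) * LV := by
          rw [abs_mul]
          exact mul_le_mul h3 (hg i) (abs_nonneg _) (by linarith)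
        simpa [hi.ne] using neg_le_of_abs_le h4
      · rw [hgh, hgt]
        simp only [if_true]
        nlinarith
      · have h0 : g i = 0 := by simp [g, hi.le.not_gt, hi.ne']
        rw [h0]
        simp only [hi.ne', if_false, mul_zero, add_zero]
        nlinarith
    have hsum := (Finset.sum_le_sum hterm).trans hbound
    have ht' : t ∈ Finset.range T := Finset.mem_range.2 (by omega)
    rw [Finset.sum_add_distrib, Finset.sum_ite_eq', if_pos ht'] at hsum
    simp only [Finset.sum_const, Finset.card_range, nsmul_eq_mul] at hsum
    rw [le_div_iff₀ hLV]
    linarith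

/-! ### Pathwise bounds -/

/-- The surrogate loss is differentiable at positive scalings. -/
theorem IsSubgradient.eq_of_surrogateLoss {d : ℕ} {δ L v g : ℝ} {z ghat : Vec d} (hv : 0 < v)
    (h : IsSubgradient (surrogateLoss δ L z ghat) v g) : g = inner ℝ z ghat + 2 * δ * L := by
  -- the surrogate is linear between `v / 2` and `2 * v`
  have h1 := h (2 * v)
  have h2 := h (v / 2)
  unfold surrogateLoss at h1 h2
  rw [abs_of_pos hv, abs_of_pos (by linarith)] at h1 h2
  apply le_antisymm <;> refine le_of_mul_le_mul_left ?_ hv <;> linarith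

section Run

variable {d T : ℕ} {R : Type*} [MeasurableSpace R] {A : ScaleLearner (Set.Ioi (0 : ℝ)) R}
  {L δ η : ℝ} {r : R} {s : ℕ → Sphere d} {ℓ : ℕ → Vec d → ℝ} {X : Trajectory d}

theorem IsRun.z_mem_closedBall
    (hX : IsRun A T L δ 0 (Metric.closedBall (0 : Vec d) 1) η r s ℓ X) {t : ℕ} (ht : t < T) :
    X.z (t + 1) ∈ Metric.closedBall (0 : Vec d) 1 := by
  simpa using hX.z_mem t ht

theorem IsRun.isMinOn_closedBall
    (hX : IsRun A T L δ 0 (Metric.closedBall (0 : Vec d) 1) η r s ℓ X) {t : ℕ} (ht : t < T) :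
    IsMinOn (fun z => η * inner ℝ z (X.ghat t) + ‖X.z t - z‖ ^ 2)
      (Metric.closedBall (0 : Vec d) 1) (X.z (t + 1)) := by
  have := hX.z_argmin t ht
  rwa [sub_zero, one_smul] at this

theorem IsRun.norm_z_le
    (hX : IsRun A T L δ 0 (Metric.closedBall (0 : Vec d) 1) η r s ℓ X) {t : ℕ} (ht : t ≤ T) :
    ‖X.z t‖ ≤ 1 := by
  cases t with
  | zero => simp [hX.z_init]
  | succ t => simpa using hX.z_mem_closedBall ht

theorem IsRun.v_pos
    (hX : IsRun A T L δ 0 (Metric.closedBall (0 : Vec d) 1) η r s ℓ X) {t : ℕ} (ht : t < T) :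
    0 < X.v t := by
  rw [hX.v_eq t ht]
  exact A.play_mem t r _

/-- The magnitude of a loss at the played point cancels the scaling in the gradient estimate. -/
theorem norm_gradientEstimate_le {f : Vec d → ℝ} {v : ℝ} {z : Vec d} (hL0 : 0 ≤ L)
    (hf : ∀ x y, |f y - f x| ≤ L * ‖y - x‖) (hf0 : f 0 = 0) (hv : 0 < v) (hz : ‖z‖ ≤ 1)
    (hδ : 0 < δ) (hδ1 : δ ≤ 1) (σ : Sphere d) :
    ‖((d : ℝ) / (v * δ) * f (v • (z + δ • (σ : Vec d)))) • (σ : Vec d)‖ ≤ 2 * d * L / δ := by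
  have hσ : ‖(σ : Vec d)‖ = 1 := by simp
  have h1 : ‖z + δ • (σ : Vec d)‖ ≤ 2 := by
    refine (norm_add_le _ _).trans ?_
    rw [norm_smul, hσ, Real.norm_of_nonneg hδ.le]
    linarith
  have h2 := hf 0 (v • (z + δ • (σ : Vec d)))
  rw [hf0, sub_zero, sub_zero, norm_smul, Real.norm_of_nonneg hv.le] at h2
  rw [norm_smul, hσ, mul_one, Real.norm_eq_abs, abs_mul, abs_of_nonneg (by positivity)]
  calc (d : ℝ) / (v * δ) * |f (v • (z + δ • (σ : Vec d)))|
      ≤ (d : ℝ) / (v * δ) * (L * (v * 2)) := by gcongr; exact h2.trans (by gcongr)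
    _ = 2 * d * L / δ := by field_simp

theorem IsRun.norm_ghat_le
    (hX : IsRun A T L δ 0 (Metric.closedBall (0 : Vec d) 1) η r s ℓ X) {t : ℕ} (ht : t < T)
    (hL0 : 0 ≤ L) (hf : ∀ x y, |ℓ t y - ℓ t x| ≤ L * ‖y - x‖) (hf0 : ℓ t 0 = 0)
    (hδ : 0 < δ) (hδ1 : δ ≤ 1) : ‖X.ghat t‖ ≤ 2 * d * L / δ := by
  rw [hX.ghat_eq t ht, hX.w_eq t ht]
  exact norm_gradientEstimate_le hL0 hf hf0 (hX.v_pos ht) (hX.norm_z_le ht.le) hδ hδ1 _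

theorem IsRun.g_eq
    (hX : IsRun A T L δ 0 (Metric.closedBall (0 : Vec d) 1) η r s ℓ X) {t : ℕ} (ht : t < T) :
    X.g t = inner ℝ (X.z t) (X.ghat t) + 2 * δ * L :=
  (hX.g_subgradient t ht).eq_of_surrogateLoss (hX.v_pos ht)

theorem IsRun.abs_inner_le
    (hX : IsRun A T L δ 0 (Metric.closedBall (0 : Vec d) 1) η r s ℓ X) {t : ℕ} (ht : t < T)
    (hL0 : 0 ≤ L) (hf : ∀ x y, |ℓ t y - ℓ t x| ≤ L * ‖y - x‖) (hf0 : ℓ t 0 = 0)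
    (hδ : 0 < δ) (hδ1 : δ ≤ 1) : |inner ℝ (X.z t) (X.ghat t)| ≤ 2 * d * L / δ :=
  calc |inner ℝ (X.z t) (X.ghat t)| ≤ ‖X.z t‖ * ‖X.ghat t‖ := abs_real_inner_le_norm _ _
    _ ≤ 1 * (2 * d * L / δ) := mul_le_mul (hX.norm_z_le ht.le)
        (hX.norm_ghat_le ht hL0 hf hf0 hδ hδ1) (norm_nonneg _) zero_le_one
    _ = 2 * d * L / δ := one_mul _

theorem IsRun.abs_g_le
    (hX : IsRun A T L δ 0 (Metric.closedBall (0 : Vec d) 1) η r s ℓ X) {t : ℕ} (ht : t < T)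
    (hL0 : 0 ≤ L) (hf : ∀ x y, |ℓ t y - ℓ t x| ≤ L * ‖y - x‖) (hf0 : ℓ t 0 = 0)
    (hδ : 0 < δ) (hδ1 : δ ≤ 1) : |X.g t| ≤ scaleLossBound d L δ := by
  rw [hX.g_eq ht, scaleLossBound]
  refine (abs_add_le _ _).trans (add_le_add (hX.abs_inner_le ht hL0 hf hf0 hδ hδ1) ?_)
  rw [abs_of_nonneg (by positivity)]

/-- The linearised regret splits into the regret of the scale learner against `V` and `V` times
the regret of gradient descent against the direction `c`. -/
theorem IsRun.sum_linearised_le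
    (hX : IsRun A T L δ 0 (Metric.closedBall (0 : Vec d) 1) η r s ℓ X) {C : ℝ} {k : ℕ}
    (hA : A.ImplementsInterface T (scaleLossBound d L δ) C k) (hη : 0 < η)
    (hL0 : 0 ≤ L) (hf : ∀ t < T, ∀ x y, |ℓ t y - ℓ t x| ≤ L * ‖y - x‖)
    (hf0 : ∀ t < T, ℓ t 0 = 0) (hδ : 0 < δ) (hδ1 : δ ≤ 1) {V : ℝ} (hV : 0 < V) {u : Vec d}
    (hu : ‖u‖ ≤ V) :
    ∑ t ∈ Finset.range T, (X.v t * inner ℝ (X.z t) (X.ghat t) + 2 * δ * L * X.v t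
        - inner ℝ (X.ghat t) u) ≤
      C * (1 + V * scaleLossBound d L δ * √(T : ℝ)) *
        (1 + Real.log (1 + (T : ℝ)) + Real.log (1 + scaleLossBound d L δ)
          + Real.log (1 + V)) ^ k
      + V * (1 / η + η / 4 * (T * (2 * d * L / δ) ^ 2)) + 2 * δ * L * V * T := by
  set c : Vec d := V⁻¹ • u with hc
  have huc : u = V • c := by rw [hc, smul_smul, mul_inv_cancel₀ hV.ne', one_smul]
  have hc1 : ‖c‖ ≤ 1 := by
    rw [hc, norm_smul, norm_inv, Real.norm_of_nonneg hV.le]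
    exact inv_mul_le_one_of_le₀ hu hV.le
  have h1 := hA r X.g (fun t ht => hX.abs_g_le ht hL0 (hf t ht) (hf0 t ht) hδ hδ1) V
    (Set.mem_Ioi.2 hV)
  rw [abs_of_pos hV] at h1
  have h2 := sum_inner_le_of_isMinOn hη (convex_closedBall (0 : Vec d) 1) (c := c)
    (by simpa using hc1) (by simpa [hX.z_init] using hc1)
    (fun t ht => hX.z_mem_closedBall ht) (fun t ht => hX.isMinOn_closedBall ht)
    (fun t ht => hX.norm_ghat_le ht hL0 (hf t ht) (hf0 t ht) hδ hδ1)
  have hsplit : ∑ t ∈ Finset.range T, (X.v t * inner ℝ (X.z t) (X.ghat t) + 2 * δ * L * X.v t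
        - inner ℝ (X.ghat t) u) =
      ∑ t ∈ Finset.range T, (A.play t r (fun i : Fin t => X.g i) - V) * X.g t
      + V * ∑ t ∈ Finset.range T, inner ℝ (X.ghat t) (X.z t - c) + 2 * δ * L * V * T := by
    have : 2 * δ * L * V * T = ∑ t ∈ Finset.range T, 2 * δ * L * V := by
      simp [mul_comm]
    rw [this, Finset.mul_sum, ← Finset.sum_add_distrib, ← Finset.sum_add_distrib]
    refine Finset.sum_congr rfl fun t ht => ?_
    have ht := Finset.mem_range.1 ht
    rw [← hX.v_eq t ht, hX.g_eq ht, huc, inner_smul_right, inner_sub_right,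
      real_inner_comm (X.z t) (X.ghat t)]
    ring
  rw [hsplit]
  have := mul_le_mul_of_nonneg_left h2 hV.le
  linarith

end Run

/-! ### Measurability and the conditional one-step bound -/

theorem measurable_comp_of_continuous {Ω : Type*} [MeasurableSpace Ω] {d : ℕ}
    {f : Ω → Vec d → ℝ} (hm : ∀ x, Measurable fun ω => f ω x) (hc : ∀ ω, Continuous (f ω))
    {Y : Ω → Vec d} (hY : Measurable Y) : Measurable fun ω => f ω (Y ω) :=
  (measurable_uncurry_of_continuous_of_measurable (u := fun x ω => f ω x) hc hm).comp
    (hY.prodMk measurable_id)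

section Measurability

variable {Ω : Type*} [MeasurableSpace Ω] {d T : ℕ} {R : Type*} [MeasurableSpace R]
  {A : ScaleLearner (Set.Ioi (0 : ℝ)) R} {L δ η : ℝ} {ρ : Ω → R} {s : ℕ → Ω → Sphere d}
  {ℓ : ℕ → Ω → Vec d → ℝ} {X : Ω → Trajectory d}

theorem measurable_v
    (hX : ∀ ω, IsRun A T L δ 0 (Metric.closedBall (0 : Vec d) 1) η (ρ ω) (fun t => s t ω)
      (fun t => ℓ t ω) (X ω)) (hρ : Measurable ρ) {t : ℕ} (ht : t < T)
    (hg : ∀ i < t, Measurable fun ω => (X ω).g i) : Measurable fun ω => (X ω).v t := by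
  simp only [fun ω => (hX ω).v_eq t ht]
  exact (A.measurable_play t).comp
    (hρ.prodMk (measurable_pi_lambda _ fun i : Fin t => hg i i.2))

theorem measurable_w
    (hX : ∀ ω, IsRun A T L δ 0 (Metric.closedBall (0 : Vec d) 1) η (ρ ω) (fun t => s t ω)
      (fun t => ℓ t ω) (X ω)) {t : ℕ} (ht : t < T)
    (hv : Measurable fun ω => (X ω).v t) (hz : Measurable fun ω => (X ω).z t)
    (hs : Measurable (s t)) : Measurable fun ω => (X ω).w t := by
  simp only [fun ω => (hX ω).w_eq t ht]
  exact hv.smul (hz.add ((measurable_subtype_coe.comp hs).const_smul δ))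

theorem measurable_ghat
    (hX : ∀ ω, IsRun A T L δ 0 (Metric.closedBall (0 : Vec d) 1) η (ρ ω) (fun t => s t ω)
      (fun t => ℓ t ω) (X ω)) {t : ℕ} (ht : t < T)
    (hv : Measurable fun ω => (X ω).v t) (hw : Measurable fun ω => (X ω).w t)
    (hs : Measurable (s t)) (hm : ∀ x, Measurable fun ω => ℓ t ω x)
    (hc : ∀ ω, Continuous (ℓ t ω)) : Measurable fun ω => (X ω).ghat t := by
  simp only [fun ω => (hX ω).ghat_eq t ht]
  exact (((measurable_const.div (hv.mul_const δ))).mul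
    (measurable_comp_of_continuous hm hc hw)).smul (measurable_subtype_coe.comp hs)

/-- Every quantity of the algorithm is a measurable function of the seed, the directions and the
losses of the earlier rounds. -/
theorem measurable_z_g
    (hX : ∀ ω, IsRun A T L δ 0 (Metric.closedBall (0 : Vec d) 1) η (ρ ω) (fun t => s t ω)
      (fun t => ℓ t ω) (X ω)) (hρ : Measurable ρ) (n : ℕ) (hn : n ≤ T)
    (hs : ∀ t < n, Measurable (s t)) (hm : ∀ t < n, ∀ x, Measurable fun ω => ℓ t ω x)
    (hc : ∀ t < n, ∀ ω, Continuous (ℓ t ω)) :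
    (Measurable fun ω => (X ω).z n) ∧ ∀ i < n, Measurable fun ω => (X ω).g i := by
  induction n with
  | zero =>
    refine ⟨?_, fun i hi => absurd hi (Nat.not_lt_zero i)⟩
    simp only [fun ω => (hX ω).z_init]
    exact measurable_const
  | succ n ih =>
    obtain ⟨hz, hg⟩ := ih (by omega) (fun t ht => hs t (by omega)) (fun t ht => hm t (by omega))
      (fun t ht => hc t (by omega))
    have hv := measurable_v hX hρ hn hg
    have hw := measurable_w hX hn hv hz (hs n n.lt_succ_self)
    have hgh := measurable_ghat hX hn hv hw (hs n n.lt_succ_self) (hm n n.lt_succ_self)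
      (hc n n.lt_succ_self)
    constructor
    · simp only [fun ω => eq_ballProj_of_isMinOn ((hX ω).z_mem_closedBall hn)
        ((hX ω).isMinOn_closedBall hn)]
      exact continuous_ballProj.measurable.comp (hz.sub (hgh.const_smul (η / 2)))
    · intro i hi
      rcases Nat.lt_succ_iff_lt_or_eq.1 hi with hi | rfl
      · exact hg i hi
      · simp only [fun ω => (hX ω).g_eq hn]
        exact (hz.inner hgh).add_const _

end Measurability

/-- Freezing: the expectation of a function of independent `Y` and `s` is computed by integrating
over `s` first. -/
theorem integral_le_of_indepFun {Ω Ω' S : Type*} [MeasurableSpace Ω] [MeasurableSpace Ω']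
    [MeasurableSpace S] {P : Measure Ω} [IsProbabilityMeasure P] {Y : Ω → Ω'} {s : Ω → S}
    (hY : Measurable Y) (hs : Measurable s) (hind : IndepFun Y s P) {G : Ω' × S → ℝ}
    (hG : Measurable G) {M : ℝ} (hM : ∀ p, |G p| ≤ M) {H : Ω' → ℝ}
    (hH : Integrable H (P.map Y)) (hle : ∀ y, ∫ σ, G (y, σ) ∂(P.map s) ≤ H y) :
    ∫ ω, G (Y ω, s ω) ∂P ≤ ∫ ω, H (Y ω) ∂P := by
  have : IsProbabilityMeasure (P.map Y) := Measure.isProbabilityMeasure_map hY.aemeasurable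
  have : IsProbabilityMeasure (P.map s) := Measure.isProbabilityMeasure_map hs.aemeasurable
  have hint : Integrable G ((P.map Y).prod (P.map s)) :=
    Integrable.of_bound hG.aestronglyMeasurable M (ae_of_all _ hM)
  calc ∫ ω, G (Y ω, s ω) ∂P = ∫ p, G p ∂(P.map fun ω => (Y ω, s ω)) :=
        (integral_map (hY.prodMk hs).aemeasurable hG.aestronglyMeasurable).symm
    _ = ∫ p, G p ∂((P.map Y).prod (P.map s)) := by
        rw [hind.map_prod_eq_prod_map_map hY.aemeasurable hs.aemeasurable]
    _ = ∫ y, ∫ σ, G (y, σ) ∂(P.map s) ∂(P.map Y) := integral_prod _ hint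
    _ ≤ ∫ y, H y ∂(P.map Y) := integral_mono hint.integral_prod_left hH hle
    _ = ∫ ω, H (Y ω) ∂P := integral_map hY.aemeasurable hH.aestronglyMeasurable

/-- The gradient estimate linearises the loss in expectation, up to an error `L * v * δ`. -/
theorem integral_gradientEstimate_le {Ω Ω' : Type*} [MeasurableSpace Ω] [MeasurableSpace Ω']
    {P : Measure Ω} [IsProbabilityMeasure P] {d : ℕ} (hd : 0 < d) {Y : Ω → Ω'} {σ : Ω → Sphere d}
    (hY : Measurable Y) (hσ : Measurable σ) (hind : IndepFun Y σ P)
    (hlaw : P.map σ = uniformSphere d) {L δ V : ℝ} {v : Ω' → ℝ} {z : Ω' → Vec d}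
    {f : Ω' → Vec d → ℝ} (hv : Measurable v) (hz : Measurable z)
    (hfm : ∀ x, Measurable fun y => f y x) (hfc : ∀ y, ConvexOn ℝ Set.univ (f y))
    (hfL : ∀ y a b, |f y b - f y a| ≤ L * ‖b - a‖) (hf0 : ∀ y, f y 0 = 0) (hL0 : 0 ≤ L)
    (hv0 : ∀ y, 0 < v y) (hvV : ∀ y, v y ≤ V) (hz1 : ∀ y, ‖z y‖ ≤ 1) (hδ : 0 < δ) (hδ1 : δ ≤ 1)
    (u : Vec d) :
    ∫ ω, (d : ℝ) / (v (Y ω) * δ) * f (Y ω) (v (Y ω) • (z (Y ω) + δ • (σ ω : Vec d)))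
        * inner ℝ (σ ω : Vec d) (u - v (Y ω) • z (Y ω)) ∂P ≤
      ∫ ω, (f (Y ω) u + L * (v (Y ω) * δ) - f (Y ω) (v (Y ω) • z (Y ω))) ∂P := by
  have hcont : ∀ y, Continuous (f y) := fun y => continuous_of_abs_sub_le hL0 (hfL y)
  have habs : ∀ y a, |f y a| ≤ L * ‖a‖ := fun y a => by
    simpa [hf0 y] using hfL y 0 a
  have hvz : ∀ y, ‖v y • z y‖ ≤ V := fun y => by
    rw [norm_smul, Real.norm_of_nonneg (hv0 y).le]
    nlinarith [hv0 y, hvV y, hz1 y, norm_nonneg (z y)]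
  have hV0 : ∀ y : Ω', 0 ≤ V := fun y => (hv0 y).le.trans (hvV y)
  have hv1 : Measurable fun p : Ω' × Sphere d => v p.1 := hv.comp measurable_fst
  have hz' : Measurable fun p : Ω' × Sphere d => z p.1 := hz.comp measurable_fst
  have hs' : Measurable fun p : Ω' × Sphere d => (p.2 : Vec d) :=
    measurable_subtype_coe.comp measurable_snd
  have hG : Measurable fun p : Ω' × Sphere d =>
      (d : ℝ) / (v p.1 * δ) * f p.1 (v p.1 • (z p.1 + δ • (p.2 : Vec d)))
        * inner ℝ (p.2 : Vec d) (u - v p.1 • z p.1) :=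
    ((measurable_const.div (hv1.mul_const δ)).mul
      (measurable_comp_of_continuous (f := fun p : Ω' × Sphere d => f p.1)
        (fun x => (hfm x).comp measurable_fst) (fun p => hcont p.1)
        (hv1.smul (hz'.add (hs'.const_smul δ))))).mul
      (hs'.inner (measurable_const.sub (hv1.smul hz')))
  have hGb : ∀ p : Ω' × Sphere d,
      |(d : ℝ) / (v p.1 * δ) * f p.1 (v p.1 • (z p.1 + δ • (p.2 : Vec d)))
        * inner ℝ (p.2 : Vec d) (u - v p.1 • z p.1)| ≤ 2 * d * L / δ * (‖u‖ + V) := by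
    intro p
    have h1 := norm_gradientEstimate_le hL0 (hfL p.1) (hf0 p.1) (hv0 p.1) (hz1 p.1) hδ hδ1 p.2
    have h2 : ‖u - v p.1 • z p.1‖ ≤ ‖u‖ + V :=
      (norm_sub_le _ _).trans (add_le_add le_rfl (hvz p.1))
    have h3 := abs_real_inner_le_norm
      (((d : ℝ) / (v p.1 * δ) * f p.1 (v p.1 • (z p.1 + δ • (p.2 : Vec d)))) • (p.2 : Vec d))
      (u - v p.1 • z p.1)
    rw [real_inner_smul_left] at h3
    exact h3.trans (mul_le_mul h1 h2 (norm_nonneg _) (by positivity))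
  have hHm : Measurable fun y => f y u + L * (v y * δ) - f y (v y • z y) :=
    ((hfm u).add ((hv.mul_const δ).const_mul L)).sub
      (measurable_comp_of_continuous hfm hcont (hv.smul hz))
  have hHi : Integrable (fun y => f y u + L * (v y * δ) - f y (v y • z y)) (P.map Y) := by
    have : IsProbabilityMeasure (P.map Y) := Measure.isProbabilityMeasure_map hY.aemeasurable
    refine Integrable.of_bound hHm.aestronglyMeasurable (L * ‖u‖ + L * (V * 1) + L * V)
      (ae_of_all _ fun y => ?_)
    have h1 := habs y u
    have h2 := (habs y (v y • z y)).trans (mul_le_mul_of_nonneg_left (hvz y) hL0)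
    have h3 : |L * (v y * δ)| ≤ L * (V * 1) := by
      rw [abs_of_nonneg (by have := hv0 y; positivity)]
      have := hV0 y
      have := hvV y
      gcongr
    rw [Real.norm_eq_abs]
    exact (abs_sub _ _).trans (add_le_add ((abs_add_le _ _).trans (add_le_add h1 h3)) h2)
  refine integral_le_of_indepFun hY hσ hind hG hGb hHi fun y => ?_
  rw [hlaw]
  have hr : 0 < v y * δ := mul_pos (hv0 y) hδ
  have key := integral_sphere_mul_inner_le hd (hfc y) (hfL y) hL0 hr (v y • z y) (u - v y • z y)
  rw [add_sub_cancel, ← integral_const_mul] at key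
  refine le_trans (le_of_eq ?_) key
  congr with s
  rw [smul_add, smul_smul, mul_assoc]

/-! ### The choice of parameters -/

theorem smoothing_pos {d T : ℕ} (hd : 0 < d) (hT : 0 < T) : 0 < smoothing d T := by
  have hd' : (0 : ℝ) < d := Nat.cast_pos.2 hd
  have hT' : (0 : ℝ) < T := Nat.cast_pos.2 hT
  exact lt_min one_pos (by positivity)

theorem learningRate_eq {d T : ℕ} {L δ : ℝ} (hL : 0 ≤ L) (hδ : 0 ≤ δ) :
    learningRate d T L δ = δ / (2 * (d * L) * √(T : ℝ)) := by
  rw [learningRate]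
  have : δ ^ 2 / (4 * ((d : ℝ) * L) ^ 2 * (T : ℝ)) = (δ / (2 * (d * L) * √(T : ℝ))) ^ 2 := by
    rw [div_pow, mul_pow _ √(T : ℝ), Real.sq_sqrt (Nat.cast_nonneg T)]
    congr 1
    ring
  rw [this, Real.sqrt_sq (by positivity)]

/-- The rate `d √T / δ` of the two learners and the bias `δ T` are balanced by the choice
`δ = min {1, √d T^(-1/4)}`. -/
theorem smoothing_balance {d T : ℕ} (hd : 0 < d) (hT : 0 < T) :
    d * √(T : ℝ) / smoothing d T ≤ d * √(T : ℝ) + √(d : ℝ) * (T : ℝ) ^ (3 / 4 : ℝ) ∧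
    smoothing d T * T ≤ √(d : ℝ) * (T : ℝ) ^ (3 / 4 : ℝ) ∧
    1 / smoothing d T ≤ 1 + T := by
  have hd' : (0 : ℝ) < d := Nat.cast_pos.2 hd
  have hT' : (0 : ℝ) < T := Nat.cast_pos.2 hT
  have hT1 : (1 : ℝ) ≤ T := Nat.one_le_cast.2 hT
  have hd1 : (1 : ℝ) ≤ √(d : ℝ) := Real.one_le_sqrt.2 (Nat.one_le_cast.2 hd)
  have hsd : (0 : ℝ) < √(d : ℝ) := by linarith
  have hinv : 1 / smoothing d T ≤ 1 + (T : ℝ) ^ (1 / 4 : ℝ) / √(d : ℝ) := by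
    have hq : 0 < (T : ℝ) ^ (1 / 4 : ℝ) := by positivity
    have hy : √(d : ℝ) * (T : ℝ) ^ (-(1 / 4) : ℝ) = ((T : ℝ) ^ (1 / 4 : ℝ) / √(d : ℝ))⁻¹ := by
      rw [Real.rpow_neg hT'.le, inv_div]
      rfl
    rw [smoothing, hy]
    rcases min_choice (1 : ℝ) ((T : ℝ) ^ (1 / 4 : ℝ) / √(d : ℝ))⁻¹ with h | h <;> rw [h]
    · rw [div_one]; linarith [div_pos hq hsd]
    · rw [one_div, inv_inv]; linarith
  refine ⟨?_, ?_, ?_⟩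
  · have hpow : √(T : ℝ) * (T : ℝ) ^ (1 / 4 : ℝ) = (T : ℝ) ^ (3 / 4 : ℝ) := by
      rw [Real.sqrt_eq_rpow, ← Real.rpow_add hT']
      norm_num
    have hdd : (d : ℝ) / √(d : ℝ) = √(d : ℝ) := Real.div_sqrt
    calc d * √(T : ℝ) / smoothing d T = d * √(T : ℝ) * (1 / smoothing d T) := by ring
      _ ≤ d * √(T : ℝ) * (1 + (T : ℝ) ^ (1 / 4 : ℝ) / √(d : ℝ)) := by gcongr
      _ = d * √(T : ℝ) + d / √(d : ℝ) * (√(T : ℝ) * (T : ℝ) ^ (1 / 4 : ℝ)) := by ring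
      _ = _ := by rw [hpow, hdd]
  · have hpow : (T : ℝ) ^ (-(1 / 4) : ℝ) * T = (T : ℝ) ^ (3 / 4 : ℝ) := by
      nth_rewrite 2 [← Real.rpow_one (T : ℝ)]
      rw [← Real.rpow_add hT']
      norm_num
    calc smoothing d T * T ≤ √(d : ℝ) * (T : ℝ) ^ (-(1 / 4) : ℝ) * T := by
          gcongr
          exact min_le_right _ _
      _ = _ := by rw [mul_assoc, hpow]
  · have h1 : (T : ℝ) ^ (1 / 4 : ℝ) ≤ T := by
      nth_rewrite 2 [← Real.rpow_one (T : ℝ)]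
      exact Real.rpow_le_rpow_of_exponent_le hT1 (by norm_num)
    have h2 : (T : ℝ) ^ (1 / 4 : ℝ) / √(d : ℝ) ≤ T :=
      (div_le_self (by positivity) hd1).trans h1
    linarith

theorem log_one_add_scaleLossBound_le {d T : ℕ} {L : ℝ} (hd : 0 < d) (hT : 0 < T) (hL : 0 < L) :
    Real.log (1 + scaleLossBound d L (smoothing d T)) ≤
      3 + Real.log (1 + (T : ℝ)) + Real.log (1 + L) + Real.log (1 + (d : ℝ)) := by
  have hδ := smoothing_pos hd hT
  have hδ1 : smoothing d T ≤ 1 := min_le_left _ _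
  obtain ⟨-, -, h3⟩ := smoothing_balance hd hT
  set δ := smoothing d T
  have hle : 1 + scaleLossBound d L δ ≤ 4 * (1 + T) * (1 + L) * (1 + d) := by
    have h4 : 2 * (d : ℝ) * L / δ ≤ 2 * d * L * (1 + T) := by
      rw [div_eq_mul_one_div]
      gcongr
    have h5 : 2 * δ * L ≤ 2 * 1 * L := by gcongr
    rw [scaleLossBound]
    have : 0 ≤ (T : ℝ) * L * d := by positivity
    have : 0 ≤ (T : ℝ) * L := by positivity
    have : 0 ≤ (T : ℝ) * d := by positivity
    have : 0 ≤ (d : ℝ) * L := by positivity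
    have : 0 ≤ (T : ℝ) := by positivity
    have : 0 ≤ (d : ℝ) := by positivity
    linarith
  have hlog4 : Real.log 4 ≤ 3 := by
    have := Real.log_le_sub_one_of_pos (by norm_num : (0 : ℝ) < 4)
    linarith
  have hpos : 0 < 1 + scaleLossBound d L δ := by rw [scaleLossBound]; positivity
  calc Real.log (1 + scaleLossBound d L δ)
      ≤ Real.log (4 * (1 + T) * (1 + L) * (1 + d)) := Real.log_le_log hpos hle
    _ = Real.log 4 + Real.log (1 + (T : ℝ)) + Real.log (1 + L) + Real.log (1 + (d : ℝ)) := by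
        rw [Real.log_mul, Real.log_mul, Real.log_mul] <;> positivity
    _ ≤ _ := by linarith

/-- The pathwise bound at the comparator norm `a`, with the parameters inserted: both regrets and
the bias are `O(a L (d √T + √d T^(3/4)))`, and the logarithmic factor grows at most fourfold. -/
theorem regretBound_le (C : ℝ) (k : ℕ) {d T : ℕ} {L a : ℝ} (hd : 0 < d) (hT : 0 < T) (hL : 0 < L)
    (ha : 0 ≤ a) {δ η : ℝ} (hδ : δ = smoothing d T) (hη : η = learningRate d T L δ) :
    C * (1 + a * scaleLossBound d L δ * √(T : ℝ)) *
        (1 + Real.log (1 + (T : ℝ)) + Real.log (1 + scaleLossBound d L δ)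
          + Real.log (1 + a)) ^ k
      + a * (1 / η + η / 4 * (T * (2 * d * L / δ) ^ 2)) + 2 * δ * L * a * T ≤
    (|C| * 4 * 4 ^ k + 5) * (1 + a * L * (d : ℝ) * √(T : ℝ)
        + a * L * √(d : ℝ) * (T : ℝ) ^ (3 / 4 : ℝ)) *
      (1 + Real.log (1 + (T : ℝ)) + Real.log (1 + L) + Real.log (1 + (d : ℝ))
        + Real.log (1 + a)) ^ k := by
  have hd' : (0 : ℝ) < d := Nat.cast_pos.2 hd
  have hT' : (0 : ℝ) < T := Nat.cast_pos.2 hT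
  have hδ0 : 0 < δ := hδ ▸ smoothing_pos hd hT
  have hδ1 : δ ≤ 1 := hδ ▸ min_le_left _ _
  obtain ⟨b1, b2, -⟩ := smoothing_balance hd hT
  have blog := log_one_add_scaleLossBound_le hd hT hL
  rw [← hδ] at b1 b2 blog
  have hd1 : (1 : ℝ) ≤ d := Nat.one_le_cast.2 hd
  set S := √(T : ℝ) with hS
  have hS0 : 0 < S := Real.sqrt_pos.2 hT'
  have hS2 : S ^ 2 = T := Real.sq_sqrt hT'.le
  set Q := √(d : ℝ) * (T : ℝ) ^ (3 / 4 : ℝ) with hQ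
  have hQ0 : 0 ≤ Q := by positivity
  set LV := scaleLossBound d L δ with hLV
  have hLV0 : 0 ≤ LV := by rw [hLV, scaleLossBound]; positivity
  have hM : 1 + a * L * (d : ℝ) * S + a * L * √(d : ℝ) * (T : ℝ) ^ (3 / 4 : ℝ) =
      1 + a * L * (d * S + Q) := by rw [hQ]; ring
  rw [hM]
  set M := 1 + a * L * (d * S + Q) with hMdef
  have haL : 0 ≤ a * L := by positivity
  have hM1 : 1 ≤ M := by
    have : 0 ≤ a * L * (d * S + Q) := by positivity
    linarith
  have lT : 0 ≤ Real.log (1 + (T : ℝ)) := Real.log_nonneg (by linarith)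
  have lL : 0 ≤ Real.log (1 + L) := Real.log_nonneg (by linarith)
  have ld : 0 ≤ Real.log (1 + (d : ℝ)) := Real.log_nonneg (by linarith)
  have la : 0 ≤ Real.log (1 + a) := Real.log_nonneg (by linarith)
  have lV : 0 ≤ Real.log (1 + LV) := Real.log_nonneg (by linarith)
  set Λ := 1 + Real.log (1 + (T : ℝ)) + Real.log (1 + L) + Real.log (1 + (d : ℝ))
    + Real.log (1 + a) with hΛ
  have hΛ1 : 1 ≤ Λ ^ k := one_le_pow₀ (by linarith)
  have p1 : (1 + Real.log (1 + (T : ℝ)) + Real.log (1 + LV) + Real.log (1 + a)) ^ k ≤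
      4 ^ k * Λ ^ k := by
    rw [← mul_pow]
    exact pow_le_pow_left₀ (by linarith) (by linarith) k
  have p2 : 1 + a * LV * S ≤ 4 * M := by
    have e : a * LV * S = 2 * (a * L) * (d * S / δ) + 2 * (a * L) * (δ * S) := by
      rw [hLV, scaleLossBound]; ring
    have h1 : 2 * (a * L) * (d * S / δ) ≤ 2 * (a * L) * (d * S + Q) := by gcongr
    have h2 : δ * S ≤ d * S := by gcongr; linarith
    have h3 : 2 * (a * L) * (δ * S) ≤ 2 * (a * L) * (d * S + Q) := by gcongr; linarith
    rw [e]
    linarith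
  have p3 : a * (1 / η + η / 4 * (T * (2 * d * L / δ) ^ 2)) ≤ 5 / 2 * (M - 1) := by
    have e : a * (1 / η + η / 4 * (T * (2 * d * L / δ) ^ 2)) =
        5 / 2 * (a * L * (d * S / δ)) := by
      rw [hη, learningRate_eq hL.le hδ0.le, ← hS, ← hS2]
      field_simp
      ring
    have h1 : a * L * (d * S / δ) ≤ a * L * (d * S + Q) := by gcongr
    rw [e]
    linarith
  have p4 : 2 * δ * L * a * T ≤ 2 * (M - 1) := by
    have e : 2 * δ * L * a * T = 2 * (a * L * (δ * T)) := by ring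
    have h0 : 0 ≤ d * S := by positivity
    have h1 : a * L * (δ * T) ≤ a * L * (d * S + Q) := by gcongr; linarith
    rw [e]
    linarith
  have p5 : C * (1 + a * LV * S) *
      (1 + Real.log (1 + (T : ℝ)) + Real.log (1 + LV) + Real.log (1 + a)) ^ k ≤
      |C| * (4 * M) * (4 ^ k * Λ ^ k) := by
    have := le_abs_self C
    gcongr
  have p6 : 5 * M ≤ 5 * M * Λ ^ k := le_mul_of_one_le_right (by linarith) hΛ1
  linear_combination p5 + p3 + p4 + p6 + 1 / 2 * hM1

/-! ### The expected regret -/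

section Expectation

variable {Ω : Type*} [mΩ : MeasurableSpace Ω] {P : Measure Ω} [IsProbabilityMeasure P]
  {ℱ : Filtration ℕ mΩ} {d T : ℕ} {R : Type*} [MeasurableSpace R]
  {A : ScaleLearner (Set.Ioi (0 : ℝ)) R} {L δ η : ℝ} {ρ : Ω → R} {s : ℕ → Ω → Sphere d}
  {ℓ : ℕ → Ω → Vec d → ℝ} {X : Ω → Trajectory d}

/-- In every round the expected regret is at most the expected linearised regret: one error
`L * v * δ` comes from the gradient estimate, the other from playing `v * (z + δ * s)` instead of
`v * z`. -/
theorem integrable_and_integral_loss_le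
    (hd : 0 < d) (hL : 0 < L) (hδ : 0 < δ) (hδ1 : δ ≤ 1) {C : ℝ} {k : ℕ}
    (hA : A.ImplementsInterface T (scaleLossBound d L δ) C k) (hρ : Measurable[ℱ 0] ρ)
    (hs : IsUniformSampling P ℱ s) (hℓ : IsEnvironment ℱ T L ℓ)
    (hX : ∀ ω, IsRun A T L δ 0 (Metric.closedBall (0 : Vec d) 1) η (ρ ω) (fun t => s t ω)
      (fun t => ℓ t ω) (X ω)) (u : Vec d) {t : ℕ} (ht : t < T) :
    Integrable (fun ω => ℓ t ω ((X ω).w t) - ℓ t ω u) P ∧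
    Integrable (fun ω => (X ω).v t * inner ℝ ((X ω).z t) ((X ω).ghat t) + 2 * δ * L * (X ω).v t
      - inner ℝ ((X ω).ghat t) u) P ∧
    ∫ ω, (ℓ t ω ((X ω).w t) - ℓ t ω u) ∂P ≤
      ∫ ω, ((X ω).v t * inner ℝ ((X ω).z t) ((X ω).ghat t) + 2 * δ * L * (X ω).v t
      - inner ℝ ((X ω).ghat t) u) ∂P := by
  have hLV : 0 < scaleLossBound d L δ := by rw [scaleLossBound]; positivity
  have hcont : ∀ i < T, ∀ ω, Continuous (ℓ i ω) := fun i hi ω =>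
    continuous_of_abs_sub_le hL.le (hℓ.lipschitz i hi ω)
  -- what is known before round `t`
  obtain ⟨hzF, hgF⟩ := @measurable_z_g Ω (ℱ t) d T R _ A L δ η ρ s ℓ X hX
    (hρ.mono (ℱ.mono (Nat.zero_le t)) le_rfl) t ht.le
    (fun i hi => (hs.measurable i).mono (ℱ.mono hi) le_rfl)
    (fun i hi x => (hℓ.measurable i (hi.trans ht) x).mono (ℱ.mono hi.le) le_rfl)
    (fun i hi => hcont i (hi.trans ht))
  have hvF := @measurable_v Ω (ℱ t) d T R _ A L δ η ρ s ℓ X hX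
    (hρ.mono (ℱ.mono (Nat.zero_le t)) le_rfl) t ht hgF
  have hℓF := hℓ.measurable t ht
  have hle : ℱ t ≤ mΩ := ℱ.le t
  have hz : Measurable fun ω => (X ω).z t := hzF.mono hle le_rfl
  have hv : Measurable fun ω => (X ω).v t := hvF.mono hle le_rfl
  have hℓm : ∀ x, Measurable fun ω => ℓ t ω x := fun x => (hℓF x).mono hle le_rfl
  have hst : Measurable (s t) := (hs.measurable t).mono (ℱ.le _) le_rfl
  have hw := measurable_w hX ht hv hz hst
  have hgh := measurable_ghat hX ht hv hw hst hℓm (hcont t ht)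
  have hv0 : ∀ ω, 0 < (X ω).v t := fun ω => (hX ω).v_pos ht
  have hz1 : ∀ ω, ‖(X ω).z t‖ ≤ 1 := fun ω => (hX ω).norm_z_le ht.le
  obtain ⟨V, hVb⟩ := hA.exists_play_le hLV
  have hvV : ∀ ω, (X ω).v t ≤ V := fun ω => by
    rw [(hX ω).v_eq t ht]
    exact hVb t ht _ _ fun i => (hX ω).abs_g_le (i.2.trans ht) hL.le
      (hℓ.lipschitz i (i.2.trans ht) ω) (hℓ.zero i (i.2.trans ht) ω) hδ hδ1
  have habs : ∀ ω a, |ℓ t ω a| ≤ L * ‖a‖ := fun ω a => by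
    simpa [hℓ.zero t ht ω] using hℓ.lipschitz t ht ω 0 a
  have hwV : ∀ ω, ‖(X ω).w t‖ ≤ V * 2 := fun ω => by
    have hn : ‖(X ω).z t + δ • (s t ω : Vec d)‖ ≤ 2 := by
      refine (norm_add_le _ _).trans ?_
      rw [norm_smul, Real.norm_of_nonneg hδ.le, norm_eq_of_mem_sphere]
      linarith [hz1 ω]
    rw [(hX ω).w_eq t ht, norm_smul, Real.norm_of_nonneg (hv0 ω).le]
    exact mul_le_mul (hvV ω) hn (norm_nonneg _) ((hv0 ω).le.trans (hvV ω))
  have hghb : ∀ ω, ‖(X ω).ghat t‖ ≤ 2 * d * L / δ := fun ω =>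
    (hX ω).norm_ghat_le ht hL.le (hℓ.lipschitz t ht ω) (hℓ.zero t ht ω) hδ hδ1
  have hzb : ∀ ω, |inner ℝ ((X ω).z t) ((X ω).ghat t)| ≤ 2 * d * L / δ := fun ω =>
    (hX ω).abs_inner_le ht hL.le (hℓ.lipschitz t ht ω) (hℓ.zero t ht ω) hδ hδ1
  -- integrability of the four terms
  have iv : Integrable (fun ω => (X ω).v t) P :=
    Integrable.of_bound hv.aestronglyMeasurable V (ae_of_all _ fun ω => by
      rw [Real.norm_of_nonneg (hv0 ω).le]; exact hvV ω)
  have iu : Integrable (fun ω => ℓ t ω u) P :=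
    Integrable.of_bound (hℓm u).aestronglyMeasurable (L * ‖u‖) (ae_of_all _ fun ω => habs ω u)
  have iw : Integrable (fun ω => ℓ t ω ((X ω).w t)) P :=
    Integrable.of_bound (measurable_comp_of_continuous hℓm (hcont t ht) hw).aestronglyMeasurable
      (L * (V * 2)) (ae_of_all _ fun ω =>
        (habs ω _).trans (mul_le_mul_of_nonneg_left (hwV ω) hL.le))
  have iz : Integrable (fun ω => ℓ t ω ((X ω).v t • (X ω).z t)) P := by
    refine Integrable.of_bound (measurable_comp_of_continuous hℓm (hcont t ht)
      (hv.smul hz)).aestronglyMeasurable (L * V) (ae_of_all _ fun ω =>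
        (habs ω _).trans (mul_le_mul_of_nonneg_left ?_ hL.le))
    rw [norm_smul, Real.norm_of_nonneg (hv0 ω).le]
    nlinarith [hv0 ω, hvV ω, hz1 ω, norm_nonneg ((X ω).z t)]
  have ivz : Integrable (fun ω => (X ω).v t * inner ℝ ((X ω).z t) ((X ω).ghat t)) P := by
    refine Integrable.of_bound (hv.mul (hz.inner hgh)).aestronglyMeasurable
      (V * (2 * d * L / δ)) (ae_of_all _ fun ω => ?_)
    rw [norm_mul, Real.norm_of_nonneg (hv0 ω).le]
    exact mul_le_mul (hvV ω) (hzb ω) (norm_nonneg _) ((hv0 ω).le.trans (hvV ω))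
  have igu : Integrable (fun ω => inner ℝ ((X ω).ghat t) u) P := by
    refine Integrable.of_bound (hgh.inner measurable_const).aestronglyMeasurable
      (2 * d * L / δ * ‖u‖) (ae_of_all _ fun ω => ?_)
    exact (norm_inner_le_norm _ _).trans (mul_le_mul_of_nonneg_right (hghb ω) (norm_nonneg _))
  have iD : Integrable (fun ω => (X ω).v t * inner ℝ ((X ω).z t) ((X ω).ghat t)
      + 2 * δ * L * (X ω).v t - inner ℝ ((X ω).ghat t) u) P :=
    (ivz.add (iv.const_mul (2 * δ * L))).sub igu
  have iR : Integrable (fun ω => ℓ t ω ((X ω).w t) - ℓ t ω u) P := iw.sub iu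
  refine ⟨iR, iD, ?_⟩
  have hind : @IndepFun Ω Ω (Sphere d) mΩ (ℱ t) _ id (s t) P := by
    refine (@IndepFun_iff_Indep Ω Ω (Sphere d) mΩ (ℱ t) _ id (s t) P).2 ?_
    rw [MeasurableSpace.comap_id]
    exact (hs.indep t).symm
  have key := @integral_gradientEstimate_le Ω Ω mΩ (ℱ t) P _ d hd id (s t)
    (measurable_id'' hle) hst hind (hs.law t) L δ V (fun ω => (X ω).v t) (fun ω => (X ω).z t)
    (ℓ t) hvF hzF hℓF (hℓ.convex t ht) (hℓ.lipschitz t ht) (hℓ.zero t ht) hL.le hv0 hvV hz1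
    hδ hδ1 u
  simp only [id] at key
  have hG : ∀ ω, (d : ℝ) / ((X ω).v t * δ)
      * ℓ t ω ((X ω).v t • ((X ω).z t + δ • (s t ω : Vec d)))
      * inner ℝ (s t ω : Vec d) (u - (X ω).v t • (X ω).z t) =
      inner ℝ ((X ω).ghat t) u - (X ω).v t * inner ℝ ((X ω).z t) ((X ω).ghat t) := by
    intro ω
    rw [← (hX ω).w_eq t ht, ← real_inner_smul_left, ← (hX ω).ghat_eq t ht, inner_sub_right,
      real_inner_smul_right, real_inner_comm ((X ω).ghat t) ((X ω).z t)]
  simp only [hG] at key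
  have iG : Integrable (fun ω => inner ℝ ((X ω).ghat t) u
      - (X ω).v t * inner ℝ ((X ω).z t) ((X ω).ghat t)) P := igu.sub ivz
  have iH : Integrable (fun ω => ℓ t ω u + L * ((X ω).v t * δ)
      - ℓ t ω ((X ω).v t • (X ω).z t)) P := (iu.add ((iv.mul_const δ).const_mul L)).sub iz
  have hpt : ∀ ω, ℓ t ω ((X ω).w t) ≤ ℓ t ω ((X ω).v t • (X ω).z t) + L * ((X ω).v t * δ) := by
    intro ω
    have h1 := (le_abs_self _).trans
      (hℓ.lipschitz t ht ω ((X ω).v t • (X ω).z t) ((X ω).w t))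
    have h2 : (X ω).w t - (X ω).v t • (X ω).z t = ((X ω).v t * δ) • (s t ω : Vec d) := by
      rw [(hX ω).w_eq t ht]; module
    rw [h2, norm_smul, norm_eq_of_mem_sphere, mul_one,
      Real.norm_of_nonneg (mul_pos (hv0 ω) hδ).le] at h1
    linarith
  have hmono : ∫ ω, ((ℓ t ω u + L * ((X ω).v t * δ) - ℓ t ω ((X ω).v t • (X ω).z t))
      - (inner ℝ ((X ω).ghat t) u - (X ω).v t * inner ℝ ((X ω).z t) ((X ω).ghat t))) ∂P ≤
      ∫ ω, (((X ω).v t * inner ℝ ((X ω).z t) ((X ω).ghat t) + 2 * δ * L * (X ω).v t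
      - inner ℝ ((X ω).ghat t) u) - (ℓ t ω ((X ω).w t) - ℓ t ω u)) ∂P :=
    integral_mono (iH.sub iG) (iD.sub iR) fun ω => by
      have := hpt ω
      simp only
      linarith
  rw [integral_sub iH iG, integral_sub iD iR] at hmono
  linarith

end Expectation

end ConvexBandit

theorem mainTheorem2 (C : ℝ) (k : ℕ) :
    ∃ (C' : ℝ) (k' : ℕ),
      ∀ (d T : ℕ) (L : ℝ), 0 < d → 0 < T → 0 < L →
      ∀ (R : Type*) [MeasurableSpace R] (A : ConvexBandit.ScaleLearner (Set.Ioi (0 : ℝ)) R),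
      A.ImplementsInterface T
        (ConvexBandit.scaleLossBound d L (ConvexBandit.smoothing d T)) C k →
      ∀ (Ω : Type*) [mΩ : MeasurableSpace Ω] (P : Measure Ω) [IsProbabilityMeasure P]
        (ℱ : Filtration ℕ mΩ)
        (ρ : Ω → R) (s : ℕ → Ω → ConvexBandit.Sphere d)
        (ℓ : ℕ → Ω → ConvexBandit.Vec d → ℝ) (X : Ω → ConvexBandit.Trajectory d),
      Measurable[ℱ 0] ρ →
      ConvexBandit.IsUniformSampling P ℱ s →
      ConvexBandit.IsEnvironment ℱ T L ℓ →
      (∀ ω, ConvexBandit.IsRun A T L (ConvexBandit.smoothing d T) 0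
        (Metric.closedBall (0 : ConvexBandit.Vec d) 1)
        (ConvexBandit.learningRate d T L (ConvexBandit.smoothing d T))
        (ρ ω) (fun t => s t ω) (fun t => ℓ t ω) (X ω)) →
      ∀ u : ConvexBandit.Vec d,
        Integrable (fun ω => ConvexBandit.regret T (fun t => ℓ t ω) (X ω).w u) P ∧
        ∫ ω, ConvexBandit.regret T (fun t => ℓ t ω) (X ω).w u ∂P ≤
          C' * (1 + ‖u‖ * L * (d : ℝ) * √(T : ℝ)
                + ‖u‖ * L * √(d : ℝ) * (T : ℝ) ^ (3 / 4 : ℝ)) *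
            (1 + Real.log (1 + (T : ℝ)) + Real.log (1 + L) + Real.log (1 + (d : ℝ))
              + Real.log (1 + ‖u‖)) ^ k' := by
  refine ⟨|C| * 4 * 4 ^ k + 5, k, ?_⟩
  intro d T L hd hT hL R _ A hA Ω mΩ P _ ℱ ρ s ℓ X hρ hs hℓ hX u
  obtain ⟨δ, hδ⟩ : ∃ δ, δ = ConvexBandit.smoothing d T := ⟨_, rfl⟩
  obtain ⟨η, hη⟩ : ∃ η, η = ConvexBandit.learningRate d T L δ := ⟨_, rfl⟩
  rw [← hδ] at hA hX
  rw [← hη] at hX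
  have hδ0 : 0 < δ := hδ ▸ ConvexBandit.smoothing_pos hd hT
  have hδ1 : δ ≤ 1 := hδ ▸ min_le_left _ _
  have hd' : (0 : ℝ) < d := Nat.cast_pos.2 hd
  have hT' : (0 : ℝ) < T := Nat.cast_pos.2 hT
  have hη0 : 0 < η := by
    rw [hη, ConvexBandit.learningRate_eq hL.le hδ0.le]
    positivity
  have hround := fun t (ht : t ∈ Finset.range T) =>
    ConvexBandit.integrable_and_integral_loss_le hd hL hδ0 hδ1 hA hρ hs hℓ hX u
      (Finset.mem_range.1 ht)
  refine ⟨integrable_finsetSum _ fun t ht => (hround t ht).1, ?_⟩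
  refine le_trans ?_ (ConvexBandit.regretBound_le C k hd hT hL (norm_nonneg u) hδ hη)
  -- the interface only covers positive scalings, so the scaling `‖u‖` is approached from above
  refine ge_of_tendsto (x := nhdsWithin ‖u‖ (Set.Ioi ‖u‖))
    (f := fun V : ℝ => C * (1 + V * ConvexBandit.scaleLossBound d L δ * √(T : ℝ)) *
        (1 + Real.log (1 + (T : ℝ)) + Real.log (1 + ConvexBandit.scaleLossBound d L δ)
          + Real.log (1 + V)) ^ k
      + V * (1 / η + η / 4 * (T * (2 * d * L / δ) ^ 2)) + 2 * δ * L * V * T) ?_ ?_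
  · have h1 : (1 + ‖u‖ : ℝ) ≠ 0 := by positivity
    refine (ContinuousAt.tendsto ?_).mono_left nhdsWithin_le_nhds
    fun_prop (disch := exact h1)
  · filter_upwards [self_mem_nhdsWithin] with V hV
    have hV : ‖u‖ < V := hV
    simp only [ConvexBandit.regret]
    rw [integral_finsetSum _ fun t ht => (hround t ht).1]
    refine (Finset.sum_le_sum fun t ht => (hround t ht).2.2).trans ?_
    rw [← integral_finsetSum _ fun t ht => (hround t ht).2.1]
    refine (integral_mono (integrable_finsetSum _ fun t ht => (hround t ht).2.1)
      (integrable_const _) fun ω => (hX ω).sum_linearised_le hA hη0 hL.le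
        (fun t ht => hℓ.lipschitz t ht ω) (fun t ht => hℓ.zero t ht ω) hδ0 hδ1
        ((norm_nonneg u).trans_lt hV) hV.le).trans ?_
    simp
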